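/- Let $\sigma_1,\sigma_2,\sigma_3$ be the Pauli matrices, and let $A=a_0\mathbb 1+a\cdot\sigma$ and $B=b_0\mathbb 1+b\cdot\sigma$ be qubit observables with $(a_0,a),(b_0,b)\in\mathbb R^4$, where $a,b\in\mathbb R^3$ are linearly independent. Let $\rho$ be the random qubit state obtained by tracing out one of the two subsystems (either one) of the random pure state $U|\Phi\rangle$ on $\mathbb C^2\otimes\mathbb C^2$, where $\Phi$ is a fixed unit vector and $U$ is distributed according to the Haar probability measure on the unitary group of $\mathbb C^2\otimes\mathbb C^2$. Write $\langle A\rangle_\rho=\operatorname{Tr}(A\rho)$ and $\Delta_\rho A=\sqrt{\langle A^2\rangle_\rho-\langle A\rangle_\rho^2}$, and put $$f_{\langle A\rangle,\langle B\rangle}(r,s)=\frac{3}{2\pi\sqrt{\det T}}\sqrt{1-\omega(r,s)^2}\,H(1-\omega(r,s)),\qquad \omega(r,s)=\sqrt{(r-a_0,s-b_0)\,T^{-1}(r-a_0,s-b_0)^{\mathsf t}},$$ where $T=\begin{pmatrix}\langle a,a\rangle&\langle a,b\rangle\\ \langle b,a\rangle&\langle b,b\rangle\end{pmatrix}$, $H$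 is the Heaviside function, and the right-hand side is read as $0$ where $\omega(r,s)>1$. Then $f_{\langle A\rangle,\langle B\rangle}$ is the joint probability density (with respect to Lebesgue measure on $\mathbb R^2$) of $(\langle A\rangle_\rho,\langle B\rangle_\rho)$, and the pair $(\Delta_\rho A,\Delta_\rho B)$ has the joint probability density $$f_{\Delta A,\Delta B}(x,y)=\frac{2xy\sum_{j\in\{\pm\}}f_{\langle A\rangle,\langle B\rangle}(r_+(x),s_j(y))}{\sqrt{(|a|^2-x^2)(|b|^2-y^2)}}\qquad(0\le x<|a|,\ 0\le y<|b|),$$ and $f_{\Delta A,\Delta B}(x,y)=0$ for all other $(x,y)\in\mathbb R^2$. Here $r_\pm(x)=a_0\pm\sqrt{|a|^2-x^2}$ and $s_\pm(y)=b_0\pm\sqrt{|b|^2-y^2}$. -/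

import Mathlib

open MeasureTheory

namespace QubitUncertainty

/-- Operators on the qubit Hilbert space `ℂ²`. -/
abbrev QubitOp : Type := Matrix (Fin 2) (Fin 2) ℂ

/-- Operators on `ℂ² ⊗ ℂ²`, in the product basis. -/
abbrev PairOp : Type := Matrix (Fin 2 × Fin 2) (Fin 2 × Fin 2) ℂ

/-- The full unitary group of `ℂ² ⊗ ℂ²`. -/
abbrev PairUnitary : Type := Matrix.unitaryGroup (Fin 2 × Fin 2) ℂ

noncomputable instance : MeasurableSpace QubitOp := borel QubitOp

instance : BorelSpace QubitOp := ⟨rfl⟩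

noncomputable instance : MeasurableSpace PairUnitary := borel PairUnitary

instance : BorelSpace PairUnitary := ⟨rfl⟩

instance : CompactSpace PairUnitary := by
  have hK : IsCompact (Set.univ.pi fun _ : Fin 2 × Fin 2 =>
      Set.univ.pi fun _ : Fin 2 × Fin 2 => Metric.closedBall (0 : ℂ) 1) :=
    isCompact_univ_pi fun _ => isCompact_univ_pi fun _ => isCompact_closedBall _ _
  have hcl : IsClosed {U : PairOp | U ∈ Matrix.unitaryGroup (Fin 2 × Fin 2) ℂ} := by
    simp only [Matrix.mem_unitaryGroup_iff]
    exact isClosed_eq (by fun_prop) continuous_const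
  have : IsCompact {U : PairOp | U ∈ Matrix.unitaryGroup (Fin 2 × Fin 2) ℂ} :=
    IsCompact.of_isClosed_subset hK hcl fun U hU i _ j _ => by
      simpa using entry_norm_bound_of_unitary hU i j
  exact isCompact_iff_compactSpace.mp this

/-- The Haar probability measure on the unitary group of `ℂ² ⊗ ℂ²`. -/
noncomputable def haar : Measure PairUnitary := Measure.haarMeasure ⊤

/-- The rank-one operator `|ψ⟩⟨ψ|`. -/
def ketBra (ψ : Fin 2 × Fin 2 → ℂ) : PairOp := Matrix.vecMulVec ψ (star ψ)

/-- Partial trace over the first tensor factor. -/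
def traceFst (M : PairOp) : QubitOp := Matrix.of fun i j => ∑ k, M (k, i) (k, j)

/-- Partial trace over the second tensor factor. -/
def traceSnd (M : PairOp) : QubitOp := Matrix.of fun i j => ∑ k, M (i, k) (j, k)

/-- The law of the reduced state `ρ = tr |UΦ⟩⟨UΦ|`, where `U` is Haar distributed and `tr` is a
partial trace. -/
noncomputable def stateMeasure (tr : PairOp → QubitOp)
    (Φ : EuclideanSpace ℂ (Fin 2 × Fin 2)) : Measure QubitOp :=
  haar.map fun U : PairUnitary => tr (ketBra ((U : PairOp).mulVec Φ.ofLp))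

/-- The Pauli matrices. -/
def pauli : Fin 3 → QubitOp :=
  ![!![0, 1; 1, 0], !![0, -Complex.I; Complex.I, 0], !![1, 0; 0, -1]]

/-- The qubit observable `a₀ 𝟙 + a · σ`. -/
noncomputable def observable (a₀ : ℝ) (a : EuclideanSpace ℝ (Fin 3)) : QubitOp :=
  (a₀ : ℂ) • (1 : QubitOp) + ∑ i, (a i : ℂ) • pauli i

/-- The mean value `⟨A⟩_ρ = Tr (A ρ)`. -/
noncomputable def mean (A ρ : QubitOp) : ℝ := (A * ρ).trace.re

/-- The uncertainty (standard deviation) `Δ_ρ A = √(⟨A²⟩_ρ - ⟨A⟩_ρ²)`. -/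
noncomputable def uncertainty (A ρ : QubitOp) : ℝ := √(mean (A ^ 2) ρ - mean A ρ ^ 2)

/-- The Gram matrix `T_{a,b}`. -/
noncomputable def gramMatrix (a b : EuclideanSpace ℝ (Fin 3)) : Matrix (Fin 2) (Fin 2) ℝ :=
  !![inner ℝ a a, inner ℝ a b; inner ℝ b a, inner ℝ b b]

/-- `ω_{A,B}(r,s) = √((r-a₀, s-b₀) T⁻¹ (r-a₀, s-b₀)ᵗ)`. -/
noncomputable def omega (a₀ b₀ : ℝ) (a b : EuclideanSpace ℝ (Fin 3)) (r s : ℝ) : ℝ :=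
  √(![r - a₀, s - b₀] ⬝ᵥ ((gramMatrix a b)⁻¹).mulVec ![r - a₀, s - b₀])

/-- The Heaviside function. -/
noncomputable def heaviside (t : ℝ) : ℝ := if 0 ≤ t then 1 else 0

/-- The function `f_{⟨A⟩,⟨B⟩}(r,s) = 3 / (2π √(det T)) · √(1-ω²) · H(1-ω)`. -/
noncomputable def meanDensity (a₀ b₀ : ℝ) (a b : EuclideanSpace ℝ (Fin 3)) (r s : ℝ) : ℝ :=
  3 / (2 * Real.pi * √(gramMatrix a b).det) * √(1 - omega a₀ b₀ a b r s ^ 2)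
    * heaviside (1 - omega a₀ b₀ a b r s)

/-- The function `f_{ΔA,ΔB}(x,y) = 2xy ∑_{j=±} f_{⟨A⟩,⟨B⟩}(r₊(x), s_j(y)) /
√((|a|²-x²)(|b|²-y²))` for `0 ≤ x < |a|` and `0 ≤ y < |b|`, extended by zero. -/
noncomputable def uncertaintyDensity (a₀ b₀ : ℝ) (a b : EuclideanSpace ℝ (Fin 3)) (x y : ℝ) : ℝ :=
  if (0 ≤ x ∧ x < ‖a‖) ∧ (0 ≤ y ∧ y < ‖b‖) then
    2 * x * y *
      (meanDensity a₀ b₀ a b (a₀ + √(‖a‖ ^ 2 - x ^ 2)) (b₀ + √(‖b‖ ^ 2 - y ^ 2)) +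
        meanDensity a₀ b₀ a b (a₀ + √(‖a‖ ^ 2 - x ^ 2)) (b₀ - √(‖b‖ ^ 2 - y ^ 2)))
      / √((‖a‖ ^ 2 - x ^ 2) * (‖b‖ ^ 2 - y ^ 2))
  else 0

end QubitUncertainty

/-! The joint law of the two means is found from its one-dimensional linear images. A combination
`αA + βB` is again a qubit observable, with Bloch vector `αa + βb`, so it suffices to know the law
of a single mean and to compare it with the corresponding marginal of the proposed density
(Cramér–Wold, through characteristic functions).

For one observable, `c · σ` is unitarily conjugate to `|c| σ₃`, and the conjugation is absorbed by
invariance of Haar measure. For `σ₃` the Haar orbit of a unit vector is replaced by a Gaussian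
vector in `ℂ⁴`: the mean becomes `(p - q) / (p + q)`, where `p` and `q` are independent with
densities `p e^{-p}` and `q e^{-q}`. Hence it has density `3/4 (1 - u²)` on `[-1, 1]`
(`lintegral_haar_zForm`, `lintegral_mean_observable`). On the other side, linear coordinates turn
the ellipse `ω ≤ 1` into the unit disc, and integrating `√(1 - u² - v²)` over `v` gives a half-disc
area proportional to `1 - u²` (`lintegral_meanDensity_linear`). The two agree, which yields
`map_mean_eq`.

Finally `(c · σ)² = |c|²` gives `ΔA = √(|a|² - (⟨A⟩ - a₀)²)`, and likewise for `B`. The second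
density is therefore the first one folded in both variables; central symmetry of the ellipse
identifies the four sign branches in pairs. -/

namespace QubitUncertainty

open scoped Matrix ENNReal Kronecker RealInnerProductSpace

/-! ### Unitary matrices acting on complex vectors -/

section Unitary

variable {n : Type*} [Fintype n] [DecidableEq n]

theorem normSq_det_of_mem_unitaryGroup {U : Matrix n n ℂ} (hU : U ∈ Matrix.unitaryGroup n ℂ) :
    Complex.normSq U.det = 1 := by
  have h := Matrix.det_of_mem_unitary hU
  have h2 := (Unitary.mem_iff.mp h).1
  have : (Complex.normSq U.det : ℂ) = 1 := by
    rw [Complex.normSq_eq_conj_mul_self]; exact h2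
  exact_mod_cast this

/-- The real determinant of a complex-linear map is the squared modulus of its complex determinant,
here 1. -/
theorem measurePreserving_mulVec {U : Matrix n n ℂ} (hU : U ∈ Matrix.unitaryGroup n ℂ) :
    MeasurePreserving (fun x : n → ℂ => U *ᵥ x) volume volume := by
  have hdet : LinearMap.det ((Matrix.toLin' U).restrictScalars ℝ) = 1 := by
    rw [LinearMap.det_restrictScalars, LinearMap.det_toLin', Algebra.norm_complex_apply,
      normSq_det_of_mem_unitaryGroup hU]
  refine ⟨by fun_prop, ?_⟩
  have h := Measure.map_linearMap_addHaar_eq_smul_addHaar (volume : Measure (n → ℂ))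
    (f := (Matrix.toLin' U).restrictScalars ℝ) (by rw [hdet]; exact one_ne_zero)
  rw [hdet] at h
  have hcoe : (fun x : n → ℂ => U *ᵥ x) = (Matrix.toLin' U).restrictScalars ℝ := by
    ext x
    simp
  rw [hcoe, h]
  simp

theorem sum_norm_sq_mulVec (U : Matrix.unitaryGroup n ℂ) (x : n → ℂ) :
    ∑ i, ‖((U : Matrix n n ℂ) *ᵥ x) i‖ ^ 2 = ∑ i, ‖x i‖ ^ 2 := by
  have h := (Unitary.mem_iff.mp U.2).1
  have e : ∀ y : n → ℂ, ((∑ i, ‖y i‖ ^ 2 : ℝ) : ℂ) = star y ⬝ᵥ y := by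
    intro y
    simp only [dotProduct, Complex.ofReal_sum, Complex.ofReal_pow, Pi.star_apply,
      RCLike.star_def, Complex.conj_mul']
  have : ((∑ i, ‖((U : Matrix n n ℂ) *ᵥ x) i‖ ^ 2 : ℝ) : ℂ) = (∑ i, ‖x i‖ ^ 2 : ℝ) := by
    rw [e, e, Matrix.star_mulVec, ← Matrix.dotProduct_mulVec, Matrix.mulVec_mulVec,
      ← Matrix.star_eq_conjTranspose, h, Matrix.one_mulVec]
  exact_mod_cast this

/-- The unitary group acts transitively on unit vectors. -/
theorem exists_unitary_mulVec_eq [Nonempty n] {x y : EuclideanSpace ℂ n} (hx : ‖x‖ = 1)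
    (hy : ‖y‖ = 1) : ∃ U : Matrix.unitaryGroup n ℂ, (U : Matrix n n ℂ) *ᵥ x.ofLp = y.ofLp := by
  obtain ⟨i⟩ := ‹Nonempty n›
  -- Each unit vector is completed to an orthonormal basis; the unitary sought carries one basis to
  -- the other.
  have key : ∀ z : EuclideanSpace ℂ n, ‖z‖ = 1 →
      ∃ b : OrthonormalBasis n ℂ (EuclideanSpace ℂ n), b i = z := by
    intro z hz
    obtain ⟨b, hb⟩ := Orthonormal.exists_orthonormalBasis_extension_of_card_eq
      (𝕜 := ℂ) (E := EuclideanSpace ℂ n) (ι := n) (by simp) (v := fun _ => z) (s := {i})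
      (by
        rw [orthonormal_iff_ite]
        rintro ⟨j, rfl⟩ ⟨k, rfl⟩
        simp [hz])
    exact ⟨b, hb i rfl⟩
  obtain ⟨b, hb⟩ := key x hx
  obtain ⟨b', hb'⟩ := key y hy
  let e := (EuclideanSpace.basisFun n ℂ)
  have hU := e.toMatrix_orthonormalBasis_mem_unitary b
  have hU' := e.toMatrix_orthonormalBasis_mem_unitary b'
  have col : ∀ c : OrthonormalBasis n ℂ (EuclideanSpace ℂ n),
      (e.toBasis.toMatrix c) *ᵥ (Pi.single i 1) = (c i).ofLp := by
    intro c
    ext j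
    simp [Module.Basis.toMatrix_apply, e]
  refine ⟨⟨_, mul_mem hU' (Unitary.star_mem hU)⟩, ?_⟩
  rw [← hb, ← hb', ← col b, ← col b', Matrix.mulVec_mulVec, mul_assoc,
    (Unitary.mem_iff.mp hU).1, mul_one]

end Unitary

/-! ### Haar averages as Gaussian averages -/

instance : SecondCountableTopology PairUnitary := by
  have : SecondCountableTopology PairOp :=
    inferInstanceAs (SecondCountableTopology (Fin 2 × Fin 2 → Fin 2 × Fin 2 → ℂ))
  exact TopologicalSpace.Subtype.secondCountableTopology _

instance : haar.IsHaarMeasure := by unfold haar; infer_instance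

instance : IsProbabilityMeasure haar :=
  ⟨by
    have := Measure.haarMeasure_self (K₀ := (⊤ : TopologicalSpace.PositiveCompacts PairUnitary))
    simpa [haar] using this⟩

/-- A right translate of Haar measure is again a Haar probability measure, hence equal to it by
uniqueness. -/
instance : haar.IsMulRightInvariant := ⟨fun g => by
  have : IsProbabilityMeasure (haar.map (· * g)) :=
    Measure.isProbabilityMeasure_map (by fun_prop)
  exact Measure.isHaarMeasure_eq_of_isProbabilityMeasure _ _⟩

/-- The average of a scale invariant function over a Haar orbit is its average against a
Gaussian weight. -/
theorem lintegral_haar_mul_lintegral {F : (Fin 2 × Fin 2 → ℂ) → ℝ≥0∞} (hF : Measurable F)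
    (hom : ∀ (t : ℝ) x, 0 < t → F ((t : ℂ) • x) = F x)
    {Φ : EuclideanSpace ℂ (Fin 2 × Fin 2)} (hΦ : ‖Φ‖ = 1) (w : ℝ → ℝ≥0∞) (hw : Measurable w) :
    (∫⁻ U : PairUnitary, F ((U : PairOp) *ᵥ Φ.ofLp) ∂haar)
        * ∫⁻ x : Fin 2 × Fin 2 → ℂ, w (∑ i, ‖x i‖ ^ 2)
      = ∫⁻ x : Fin 2 × Fin 2 → ℂ, F x * w (∑ i, ‖x i‖ ^ 2) := by
  have hc : Continuous fun p : PairUnitary × (Fin 2 × Fin 2 → ℂ) => (p.1 : PairOp) *ᵥ p.2 := by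
    fun_prop
  have hwm : Measurable fun x : Fin 2 × Fin 2 → ℂ => w (∑ i, ‖x i‖ ^ 2) := by fun_prop
  -- By transitivity `x` is a positive multiple of `V Φ`; homogeneity removes the multiple and right
  -- invariance removes `V`.
  have orbit : ∀ x : Fin 2 × Fin 2 → ℂ, x ≠ 0 →
      ∫⁻ U : PairUnitary, F ((U : PairOp) *ᵥ x) ∂haar
        = ∫⁻ U : PairUnitary, F ((U : PairOp) *ᵥ Φ.ofLp) ∂haar := by
    intro x hx
    set y : EuclideanSpace ℂ (Fin 2 × Fin 2) := WithLp.toLp 2 x with hy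
    have hy0 : y ≠ 0 := fun h => hx (by simpa [hy] using congrArg WithLp.ofLp h)
    have hpos : 0 < ‖y‖ := norm_pos_iff.mpr hy0
    obtain ⟨V, hV⟩ := exists_unitary_mulVec_eq hΦ
      (y := ((‖y‖⁻¹ : ℝ) : ℂ) • y) (by rw [norm_smul]; simp [hpos.ne'])
    have hx' : x = ((‖y‖ : ℝ) : ℂ) • ((V : PairOp) *ᵥ Φ.ofLp) := by
      rw [hV, WithLp.ofLp_smul, smul_smul, ← Complex.ofReal_mul, mul_inv_cancel₀ hpos.ne',
        Complex.ofReal_one, one_smul]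
    rw [← lintegral_mul_right_eq_self (fun U : PairUnitary => F ((U : PairOp) *ᵥ Φ.ofLp)) V, hx']
    refine lintegral_congr fun U => ?_
    rw [Matrix.mulVec_smul, hom _ _ hpos, Matrix.mulVec_mulVec]
    rfl
  -- The weight sees only the norm, so it may be evaluated at `U x`. After Tonelli, `U` drops out
  -- because it preserves Lebesgue measure.
  calc _ = ∫⁻ x : Fin 2 × Fin 2 → ℂ, (∫⁻ U : PairUnitary, F ((U : PairOp) *ᵥ x) ∂haar)
        * w (∑ i, ‖x i‖ ^ 2) := by
        rw [← lintegral_const_mul _ hwm]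
        refine lintegral_congr_ae ?_
        filter_upwards [Measure.ae_ne volume (0 : Fin 2 × Fin 2 → ℂ)] with x hx
        rw [orbit x hx]
    _ = ∫⁻ x : Fin 2 × Fin 2 → ℂ, ∫⁻ U : PairUnitary, F ((U : PairOp) *ᵥ x)
        * w (∑ i, ‖((U : PairOp) *ᵥ x) i‖ ^ 2) ∂haar := by
        refine lintegral_congr fun x => ?_
        have hx : Continuous fun U : PairUnitary => (U : PairOp) *ᵥ x := by fun_prop
        have hFx : Measurable fun U : PairUnitary => F ((U : PairOp) *ᵥ x) :=
          hF.comp hx.measurable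
        rw [← lintegral_mul_const _ hFx]
        simp_rw [sum_norm_sq_mulVec]
    _ = ∫⁻ U : PairUnitary, (∫⁻ x : Fin 2 × Fin 2 → ℂ, F ((U : PairOp) *ᵥ x)
        * w (∑ i, ‖((U : PairOp) *ᵥ x) i‖ ^ 2)) ∂haar := by
        refine lintegral_lintegral_swap (Measurable.aemeasurable ?_)
        exact (hF.mul hwm).comp (hc.measurable.comp measurable_swap)
    _ = ∫⁻ _ : PairUnitary, (∫⁻ x : Fin 2 × Fin 2 → ℂ, F x * w (∑ i, ‖x i‖ ^ 2)) ∂haar := by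
        refine lintegral_congr fun U => ?_
        exact (measurePreserving_mulVec U.2).lintegral_comp (hF.mul hwm)
    _ = _ := by simp

/-! ### Laws of squared moduli and of their ratios -/

/-- Under Lebesgue measure on `ℂ`, the squared modulus is distributed as `π` times Lebesgue
measure on the half-line. -/
theorem lintegral_norm_sq {g : ℝ → ℝ≥0∞} (hg : Measurable g) :
    ∫⁻ z : ℂ, g (‖z‖ ^ 2) = ENNReal.ofReal Real.pi * ∫⁻ t in Set.Ioi 0, g t := by
  have hinj : Set.InjOn (fun r : ℝ => r ^ 2) (Set.Ioi 0) := fun x hx y hy h =>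
    (sq_eq_sq₀ (le_of_lt hx) (le_of_lt hy)).mp h
  have himg : (fun r : ℝ => r ^ 2) '' Set.Ioi 0 = Set.Ioi 0 := by
    ext t
    constructor
    · rintro ⟨r, hr, rfl⟩
      exact pow_pos (Set.mem_Ioi.mp hr) 2
    · intro ht
      exact ⟨√t, Real.sqrt_pos.mpr ht, Real.sq_sqrt (le_of_lt ht)⟩
  have h1 : ∫⁻ t in Set.Ioi (0 : ℝ), g t
      = ∫⁻ r in Set.Ioi (0 : ℝ), ENNReal.ofReal (2 * r) * g (r ^ 2) := by
    nth_rewrite 1 [← himg]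
    rw [lintegral_image_eq_lintegral_abs_deriv_mul measurableSet_Ioi
      (f := fun r : ℝ => r ^ 2) (f' := fun r => 2 * r)
      (fun x _ => by simpa using (hasDerivAt_pow 2 x).hasDerivWithinAt) hinj]
    refine setLIntegral_congr_fun measurableSet_Ioi fun r hr => ?_
    have : (0 : ℝ) < r := hr
    rw [abs_of_pos (by positivity)]
  rw [← Complex.lintegral_comp_polarCoord_symm, h1, polarCoord_target,
    Measure.volume_eq_prod, ← Measure.prod_restrict]
  simp only [Complex.norm_polarCoord_symm, sq_abs, smul_eq_mul]
  rw [lintegral_prod _ (by fun_prop)]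
  simp only [lintegral_const, Measure.restrict_apply, MeasurableSet.univ, Set.univ_inter,
    Real.volume_Ioo]
  rw [← lintegral_const_mul _ (by fun_prop)]
  refine lintegral_congr fun r => ?_
  rw [sub_neg_eq_add, ← two_mul, ENNReal.ofReal_mul zero_le_two, ENNReal.ofReal_mul zero_le_two]
  ring

/-- Substitute `p = s + t` in the inner integral and apply Tonelli on the region `0 < s < p`. -/
theorem lintegral_Ioi_Ioi_add {g : ℝ → ℝ → ℝ≥0∞} (hg : Measurable (Function.uncurry g)) :
    ∫⁻ s in Set.Ioi (0 : ℝ), ∫⁻ t in Set.Ioi (0 : ℝ), g s (s + t)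
      = ∫⁻ p in Set.Ioi (0 : ℝ), ∫⁻ s in Set.Ioo 0 p, g s p := by
  have e1 : ∀ s, ∫⁻ t in Set.Ioi (0 : ℝ), g s (s + t) = ∫⁻ p in Set.Ioi s, g s p := by
    intro s
    rw [← lintegral_indicator measurableSet_Ioi, ← lintegral_indicator measurableSet_Ioi,
      ← lintegral_add_left_eq_self ((Set.Ioi s).indicator fun p => g s p) s]
    refine lintegral_congr fun t => ?_
    simp [Set.indicator]
  simp_rw [e1]
  have e2 : ∀ s p, (Set.Ioi (0 : ℝ)).indicator (fun s => (Set.Ioi s).indicator (g s) p) s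
      = (Set.Ioi (0 : ℝ)).indicator (fun p => (Set.Ioo 0 p).indicator (fun s => g s p) s) p := by
    intro s p
    simp only [Set.indicator, Set.mem_Ioi, Set.mem_Ioo]
    split_ifs <;> first | rfl | (exfalso; grind)
  have l1 : ∫⁻ s in Set.Ioi (0 : ℝ), ∫⁻ p in Set.Ioi s, g s p
      = ∫⁻ s, ∫⁻ p, (Set.Ioi (0 : ℝ)).indicator (fun s => (Set.Ioi s).indicator (g s) p) s := by
    rw [← lintegral_indicator measurableSet_Ioi]
    refine lintegral_congr fun s => ?_
    by_cases hs : s ∈ Set.Ioi (0 : ℝ)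
    · simp only [Set.indicator_of_mem hs]
      rw [lintegral_indicator measurableSet_Ioi]
    · simp [Set.indicator_of_notMem hs]
  have l2 : ∫⁻ p in Set.Ioi (0 : ℝ), ∫⁻ s in Set.Ioo 0 p, g s p
      = ∫⁻ p, ∫⁻ s, (Set.Ioi (0 : ℝ)).indicator
          (fun p => (Set.Ioo 0 p).indicator (fun s => g s p) s) p := by
    rw [← lintegral_indicator measurableSet_Ioi]
    refine lintegral_congr fun p => ?_
    by_cases hp : p ∈ Set.Ioi (0 : ℝ)
    · simp only [Set.indicator_of_mem hp]
      rw [lintegral_indicator measurableSet_Ioo]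
    · simp [Set.indicator_of_notMem hp]
  rw [l1, l2]
  simp_rw [← e2]
  refine lintegral_lintegral_swap (Measurable.aemeasurable ?_)
  have : (Function.uncurry fun s p => (Set.Ioi (0 : ℝ)).indicator
      (fun s => (Set.Ioi s).indicator (g s) p) s)
      = ({q : ℝ × ℝ | 0 < q.1 ∧ q.1 < q.2}).indicator (Function.uncurry g) := by
    ext ⟨s, p⟩
    simp only [Function.uncurry, Set.indicator, Set.mem_Ioi, Set.mem_ofPred_eq]
    split_ifs <;> first | rfl | (exfalso; grind)
  rw [this]
  refine hg.indicator (MeasurableSet.inter ?_ ?_)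
  · exact measurableSet_lt measurable_const measurable_fst
  · exact measurableSet_lt measurable_fst measurable_snd

/-- The weight `p` is the length of the interval of possible values of `‖z‖ ^ 2` once the sum is
fixed at `p`. -/
theorem lintegral_norm_sq_add {g : ℝ → ℝ≥0∞} (hg : Measurable g) :
    ∫⁻ z : ℂ, ∫⁻ w : ℂ, g (‖z‖ ^ 2 + ‖w‖ ^ 2)
      = ENNReal.ofReal Real.pi ^ 2 * ∫⁻ p in Set.Ioi 0, ENNReal.ofReal p * g p := by
  have h1 : ∀ z : ℂ, ∫⁻ w : ℂ, g (‖z‖ ^ 2 + ‖w‖ ^ 2)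
      = ENNReal.ofReal Real.pi * ∫⁻ t in Set.Ioi 0, g (‖z‖ ^ 2 + t) := fun z =>
    lintegral_norm_sq (g := fun t => g (‖z‖ ^ 2 + t)) (by fun_prop)
  have hm : Measurable fun s : ℝ => ∫⁻ t in Set.Ioi 0, g (s + t) :=
    Measurable.lintegral_prod_right' (f := fun q : ℝ × ℝ => g (q.1 + q.2)) (by fun_prop)
  simp_rw [h1]
  rw [lintegral_const_mul _ (by fun_prop), lintegral_norm_sq hm,
    lintegral_Ioi_Ioi_add (g := fun _ p => g p) (by unfold Function.uncurry; fun_prop),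
    ← mul_assoc, sq]
  congr 1
  refine lintegral_congr fun p => ?_
  simp [mul_comm]

/-- If `p` and `q` have densities `p e^{-p}` and `q e^{-q}` then `(p - q) / (p + q)` has density
proportional to `1 - u ^ 2`. -/
theorem lintegral_gamma_ratio {h : ℝ → ℝ≥0∞} (hh : Measurable h) {w : ℝ → ℝ≥0∞}
    (hw : Measurable w) :
    ∫⁻ p in Set.Ioi (0 : ℝ), ENNReal.ofReal p * ∫⁻ q in Set.Ioi (0 : ℝ), ENNReal.ofReal q *
        (h ((p - q) / (p + q)) * w (p + q))
      = (∫⁻ t in Set.Ioi (0 : ℝ), ENNReal.ofReal (t ^ 3 / 8) * w t)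
          * ∫⁻ u, ENNReal.ofReal (1 - u ^ 2) * h u := by
  have e1 : ∫⁻ p in Set.Ioi (0 : ℝ), ENNReal.ofReal p * ∫⁻ q in Set.Ioi (0 : ℝ),
        ENNReal.ofReal q * (h ((p - q) / (p + q)) * w (p + q))
      = ∫⁻ p in Set.Ioi (0 : ℝ), ∫⁻ q in Set.Ioi (0 : ℝ),
        (fun s t => ENNReal.ofReal s * (ENNReal.ofReal (t - s) *
          (h ((2 * s - t) / t) * w t))) p (p + q) := by
    refine lintegral_congr fun p => ?_
    rw [← lintegral_const_mul _ (by fun_prop)]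
    refine lintegral_congr fun q => ?_
    ring_nf
  rw [e1, lintegral_Ioi_Ioi_add (g := fun s t => ENNReal.ofReal s * (ENNReal.ofReal (t - s) *
      (h ((2 * s - t) / t) * w t))) (by unfold Function.uncurry; fun_prop),
    ← lintegral_mul_const _ (by fun_prop)]
  refine setLIntegral_congr_fun measurableSet_Ioi fun t ht => ?_
  have ht : 0 < t := ht
  -- With `s = p` and `t = p + q`, the ratio is `u = (2s - t) / t`, that is `s = t (1 + u) / 2`. The
  -- Jacobian `t / 2` times `s (t - s)` is `t³ / 8 * (1 - u²)`, so the variables separate.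
  have himg : (fun u : ℝ => t * (1 + u) / 2) '' Set.Ioo (-1) 1 = Set.Ioo 0 t := by
    ext s
    constructor
    · rintro ⟨u, ⟨h1, h2⟩, rfl⟩
      constructor <;> simp only <;> nlinarith
    · rintro ⟨h1, h2⟩
      refine ⟨2 * s / t - 1, ⟨?_, ?_⟩, ?_⟩
      · have : 0 < 2 * s / t := by positivity
        linarith
      · have : 2 * s / t < 2 := by rw [div_lt_iff₀ ht]; linarith
        linarith
      · simp only
        field_simp
        ring
  rw [← himg, lintegral_image_eq_lintegral_abs_deriv_mul measurableSet_Ioo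
      (f := fun u : ℝ => t * (1 + u) / 2) (f' := fun _ => t / 2)
      (fun x _ => by
        simpa using (((hasDerivAt_id x).const_add 1).const_mul t).div_const 2
          |>.hasDerivWithinAt)
      (fun x _ y _ hxy => by
        simp only at hxy
        have : t * x = t * y := by linarith
        exact mul_left_cancel₀ ht.ne' this)]
  have e2 : ∫⁻ u, ENNReal.ofReal (1 - u ^ 2) * h u
      = ∫⁻ u in Set.Ioo (-1) 1, ENNReal.ofReal (1 - u ^ 2) * h u := by
    rw [← lintegral_indicator measurableSet_Ioo]
    refine lintegral_congr fun u => ?_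
    by_cases hu : u ∈ Set.Ioo (-1 : ℝ) 1
    · rw [Set.indicator_of_mem hu]
    · rw [Set.indicator_of_notMem hu, ENNReal.ofReal_of_nonpos, zero_mul]
      by_contra! hlt
      exact hu ⟨by nlinarith, by nlinarith⟩
  rw [e2, ← lintegral_const_mul _ (by fun_prop)]
  refine setLIntegral_congr_fun measurableSet_Ioo fun u hu => ?_
  obtain ⟨hu1, hu2⟩ := hu
  have hr : (2 * (t * (1 + u) / 2) - t) / t = u := by field_simp; ring
  rw [hr, abs_of_pos (by positivity)]
  have hs : t ^ 3 / 8 * (1 - u ^ 2) = t / 2 * (t * (1 + u) / 2 * (t - t * (1 + u) / 2)) := by ring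
  have hc : ENNReal.ofReal (t ^ 3 / 8) * ENNReal.ofReal (1 - u ^ 2) = ENNReal.ofReal (t / 2) *
      (ENNReal.ofReal (t * (1 + u) / 2) * ENNReal.ofReal (t - t * (1 + u) / 2)) := by
    rw [← ENNReal.ofReal_mul (by positivity), hs, ENNReal.ofReal_mul (by positivity),
      ENNReal.ofReal_mul (by apply div_nonneg _ zero_le_two; nlinarith)]
  calc _ = (ENNReal.ofReal (t / 2) *
      (ENNReal.ofReal (t * (1 + u) / 2) * ENNReal.ofReal (t - t * (1 + u) / 2))) * (h u * w t) := by
        ring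
    _ = _ := by rw [← hc]; ring

/-! ### The law of the `σ₃` mean -/

/-- The expectation of `σ₃ ⊗ 𝟙` in the vector `x`. -/
noncomputable def zForm (x : Fin 2 × Fin 2 → ℂ) : ℝ :=
  (‖x (0, 0)‖ ^ 2 + ‖x (0, 1)‖ ^ 2) - (‖x (1, 0)‖ ^ 2 + ‖x (1, 1)‖ ^ 2)

@[fun_prop]
theorem continuous_zForm : Continuous zForm := by unfold zForm; fun_prop

theorem lintegral_pair_eq {f : (Fin 2 × Fin 2 → ℂ) → ℝ≥0∞} (hf : Measurable f) :
    ∫⁻ x, f x = ∫⁻ z₀₀ : ℂ, ∫⁻ z₀₁ : ℂ, ∫⁻ z₁₀ : ℂ, ∫⁻ z₁₁ : ℂ,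
      f (fun i => ![![z₀₀, z₀₁], ![z₁₀, z₁₁]] i.1 i.2) := by
  let e : ℂ × ℂ × ℂ × ℂ → (Fin 2 × Fin 2 → ℂ) :=
    fun z i => ![![z.1, z.2.1], ![z.2.2.1, z.2.2.2]] i.1 i.2
  have he : Measurable e := by
    refine measurable_pi_lambda _ fun ⟨i, j⟩ => ?_
    fin_cases i <;> fin_cases j <;> simp [e] <;> fun_prop
  have hmap : (volume : Measure (Fin 2 × Fin 2 → ℂ)) = volume.map e := by
    refine Measure.pi_eq fun s hs => ?_
    rw [Measure.map_apply he (MeasurableSet.univ_pi hs)]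
    have : e ⁻¹' Set.univ.pi s = s (0, 0) ×ˢ s (0, 1) ×ˢ s (1, 0) ×ˢ s (1, 1) := by
      ext ⟨a, b, c, d⟩
      simp [e, Fin.forall_fin_two, and_assoc]
    rw [this]
    simp only [Measure.volume_eq_prod, Measure.prod_prod, Fintype.prod_prod_type,
      Fin.prod_univ_two, mul_assoc]
  have m : Measurable fun z => f (e z) := hf.comp he
  rw [hmap, lintegral_map hf he, Measure.volume_eq_prod, lintegral_prod _ m.aemeasurable]
  refine lintegral_congr fun a => ?_
  have m1 : Measurable fun q : ℂ × ℂ × ℂ => f (e (a, q)) := m.comp (by fun_prop)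
  rw [Measure.volume_eq_prod, lintegral_prod _ m1.aemeasurable]
  refine lintegral_congr fun b => ?_
  have m2 : Measurable fun q : ℂ × ℂ => f (e (a, b, q)) := m.comp (by fun_prop)
  rw [Measure.volume_eq_prod, lintegral_prod _ m2.aemeasurable]

theorem lintegral_pair_norm_sq {g : ℝ → ℝ → ℝ≥0∞} (hg : Measurable (Function.uncurry g)) :
    ∫⁻ x : Fin 2 × Fin 2 → ℂ,
        g (‖x (0, 0)‖ ^ 2 + ‖x (0, 1)‖ ^ 2) (‖x (1, 0)‖ ^ 2 + ‖x (1, 1)‖ ^ 2)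
      = ENNReal.ofReal Real.pi ^ 4 * ∫⁻ p in Set.Ioi (0 : ℝ), ENNReal.ofReal p *
          ∫⁻ q in Set.Ioi (0 : ℝ), ENNReal.ofReal q * g p q := by
  have h1 : ∀ p, ∫⁻ z : ℂ, ∫⁻ w : ℂ, g p (‖z‖ ^ 2 + ‖w‖ ^ 2) = ENNReal.ofReal Real.pi ^ 2 *
      ∫⁻ q in Set.Ioi 0, ENNReal.ofReal q * g p q := fun p =>
    lintegral_norm_sq_add (hg.comp measurable_prodMk_left)
  have hm : Measurable fun p : ℝ => ∫⁻ q in Set.Ioi 0, ENNReal.ofReal q * g p q :=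
    Measurable.lintegral_prod_right'
      (f := fun r : ℝ × ℝ => ENNReal.ofReal r.2 * Function.uncurry g r) (by fun_prop)
  have hm' : Measurable fun x : Fin 2 × Fin 2 → ℂ =>
      g (‖x (0, 0)‖ ^ 2 + ‖x (0, 1)‖ ^ 2) (‖x (1, 0)‖ ^ 2 + ‖x (1, 1)‖ ^ 2) :=
    hg.comp (by fun_prop : Measurable fun x : Fin 2 × Fin 2 → ℂ =>
      (‖x (0, 0)‖ ^ 2 + ‖x (0, 1)‖ ^ 2, ‖x (1, 0)‖ ^ 2 + ‖x (1, 1)‖ ^ 2))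
  rw [lintegral_pair_eq hm']
  simp only [Matrix.cons_val_zero, Matrix.cons_val_one, h1]
  rw [lintegral_norm_sq_add (hm.const_mul _), show (4 : ℕ) = 2 + 2 from rfl, pow_add, mul_assoc]
  congr 1
  rw [← lintegral_const_mul _ (by fun_prop)]
  refine lintegral_congr fun p => ?_
  ring

theorem lintegral_one_sub_sq : ∫⁻ u : ℝ, ENNReal.ofReal (1 - u ^ 2) = ENNReal.ofReal (4 / 3) := by
  have h : ∀ u : ℝ, ENNReal.ofReal (1 - u ^ 2)
      = (Set.Icc (-1 : ℝ) 1).indicator (fun u => ENNReal.ofReal (1 - u ^ 2)) u := by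
    intro u
    by_cases hu : u ∈ Set.Icc (-1 : ℝ) 1
    · rw [Set.indicator_of_mem hu]
    · rw [Set.indicator_of_notMem hu, ENNReal.ofReal_of_nonpos]
      by_contra! hlt
      exact hu ⟨by nlinarith, by nlinarith⟩
  rw [lintegral_congr h, lintegral_indicator measurableSet_Icc, ← ofReal_integral_eq_lintegral_ofReal]
  · rw [integral_Icc_eq_integral_Ioc, ← intervalIntegral.integral_of_le (by norm_num)]
    congr 1
    rw [intervalIntegral.integral_sub (by simp) (by simp)]
    simp
    norm_num
  · exact (by fun_prop : Continuous fun u : ℝ => 1 - u ^ 2).integrableOn_Icc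
  · refine (ae_restrict_iff' measurableSet_Icc).mpr (Filter.Eventually.of_forall fun u hu => ?_)
    have := hu.1
    have := hu.2
    simp only [Pi.zero_apply]
    nlinarith

/-- The law of the `σ₃`-expectation of a reduced Haar random state. -/
theorem lintegral_haar_zForm {h : ℝ → ℝ≥0∞} (hh : Measurable h)
    {Φ : EuclideanSpace ℂ (Fin 2 × Fin 2)} (hΦ : ‖Φ‖ = 1) :
    ∫⁻ U : PairUnitary, h (zForm ((U : PairOp) *ᵥ Φ.ofLp)) ∂haar
      = ∫⁻ u : ℝ, ENNReal.ofReal (3 / 4 * (1 - u ^ 2)) * h u := by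
  let w : ℝ → ℝ≥0∞ := fun t => ENNReal.ofReal (Real.exp (-t))
  have hw : Measurable w := by fun_prop
  have key : ∀ h : ℝ → ℝ≥0∞, Measurable h →
      (∫⁻ U : PairUnitary, h (zForm ((U : PairOp) *ᵥ Φ.ofLp)) ∂haar)
          * ∫⁻ x : Fin 2 × Fin 2 → ℂ, w (∑ i, ‖x i‖ ^ 2)
        = ENNReal.ofReal Real.pi ^ 4 * (∫⁻ t in Set.Ioi (0 : ℝ), ENNReal.ofReal (t ^ 3 / 8) * w t)
          * ∫⁻ u, ENNReal.ofReal (1 - u ^ 2) * h u := by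
    intro h hh
    have hN : ∀ U : PairUnitary, ∑ i, ‖((U : PairOp) *ᵥ Φ.ofLp) i‖ ^ 2 = 1 := by
      intro U
      rw [sum_norm_sq_mulVec, ← EuclideanSpace.norm_sq_eq, hΦ, one_pow]
    have h1 := lintegral_haar_mul_lintegral
      -- Dividing by the squared norm makes the integrand scale invariant and changes nothing on the
      -- unit sphere.
      (F := fun x => h (zForm x / ∑ i, ‖x i‖ ^ 2)) (by fun_prop)
      (by
        intro t x ht
        congr 1
        have : ((t : ℂ) • x) = fun i => (t : ℂ) * x i := rfl
        simp only [this, zForm, norm_mul, mul_pow, ← Finset.mul_sum, Complex.norm_real,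
          Real.norm_eq_abs, sq_abs, ← mul_add, ← mul_sub]
        exact mul_div_mul_left _ _ (by positivity)) hΦ w hw
    simp only [hN, div_one] at h1
    rw [h1, mul_assoc, ← lintegral_gamma_ratio hh hw]
    rw [← lintegral_pair_norm_sq
      (g := fun p q => h ((p - q) / (p + q)) * w (p + q)) (by unfold Function.uncurry; fun_prop)]
    refine lintegral_congr fun x => ?_
    simp only [Fintype.sum_prod_type, Fin.sum_univ_two, zForm]
  set c := ∫⁻ x : Fin 2 × Fin 2 → ℂ, w (∑ i, ‖x i‖ ^ 2) with hc
  set K := ENNReal.ofReal Real.pi ^ 4 *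
    (∫⁻ t in Set.Ioi (0 : ℝ), ENNReal.ofReal (t ^ 3 / 8) * w t) with hK
  -- Testing with `h = 1` gives `c = K * 4/3`. The constants thus need not be evaluated: `K` cancels
  -- once it is known to be nonzero and finite.
  have hone := key (fun _ => 1) measurable_const
  simp only [lintegral_const, measure_univ, mul_one, one_mul, lintegral_one_sub_sq] at hone
  have hK0 : K ≠ 0 := by
    refine mul_ne_zero (pow_ne_zero _ (by simpa using Real.pi_pos)) ?_
    rw [Ne, lintegral_eq_zero_iff (by fun_prop)]
    intro hz
    have := (ae_restrict_iff' measurableSet_Ioi).mp hz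
    have hpos : ∀ t ∈ Set.Ioi (0 : ℝ), ENNReal.ofReal (t ^ 3 / 8) * w t ≠ 0 := by
      intro t ht
      have : 0 < t := ht
      refine mul_ne_zero ?_ ?_ <;> simp only [w, ne_eq, ENNReal.ofReal_eq_zero, not_le] <;>
        positivity
    have : ∀ᵐ t : ℝ, t ∉ Set.Ioi (0 : ℝ) := by
      filter_upwards [this] with t ht h'
      exact hpos t h' (ht h')
    rw [measure_eq_zero_iff_ae_notMem.symm] at this
    simp at this
  have hKt : K ≠ ∞ := by
    refine ENNReal.mul_ne_top (by simp) ?_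
    have hint : IntegrableOn (fun t : ℝ => t ^ 3 / 8 * Real.exp (-t)) (Set.Ioi 0) := by
      have := (Real.GammaIntegral_convergent (s := 4) (by norm_num)).div_const 8
      refine IntegrableOn.congr_fun (by exact this) (fun t ht => ?_) measurableSet_Ioi
      have e : (4 : ℝ) - 1 = (3 : ℕ) := by norm_num
      simp only [e, Real.rpow_natCast]
      ring
    have := hint.lintegral_lt_top
    refine ne_of_lt (lt_of_le_of_lt (le_of_eq ?_) this)
    refine setLIntegral_congr_fun measurableSet_Ioi fun t ht => ?_
    have : 0 < t := ht
    rw [← ENNReal.ofReal_mul (by positivity)]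
  have hk := key h hh
  rw [hone, mul_comm K, ← mul_assoc, mul_comm K] at hk
  have := (ENNReal.mul_left_inj hK0 hKt).mp hk
  calc _ = ENNReal.ofReal (3 / 4) * ((∫⁻ U : PairUnitary,
        h (zForm ((U : PairOp) *ᵥ Φ.ofLp)) ∂haar) * ENNReal.ofReal (4 / 3)) := by
        rw [mul_comm, mul_assoc, ← ENNReal.ofReal_mul (by norm_num)]
        norm_num
    _ = _ := by
        rw [this, ← lintegral_const_mul _ (by fun_prop)]
        refine lintegral_congr fun u => ?_
        rw [ENNReal.ofReal_mul (by norm_num), mul_assoc]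

/-! ### Pauli algebra, partial traces and the law of one mean -/

theorem pauli_sum_eq (c : EuclideanSpace ℝ (Fin 3)) :
    ∑ i, (c i : ℂ) • pauli i
      = !![(c 2 : ℂ), c 0 - c 1 * Complex.I; c 0 + c 1 * Complex.I, -c 2] := by
  rw [Fin.sum_univ_three]
  ext i j
  fin_cases i <;> fin_cases j <;> simp [pauli]
  ring

theorem star_fin_two (a b c d : ℂ) :
    star !![a, b; c, d] = !![star a, star c; star b, star d] := by
  ext i j
  fin_cases i <;> fin_cases j <;> rfl

/-- `c · σ` is unitarily equivalent to `|c| σ₃`. -/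
theorem exists_unitary_pauli_sum_eq (c : EuclideanSpace ℝ (Fin 3)) :
    ∃ u : Matrix.unitaryGroup (Fin 2) ℂ,
      ∑ i, (c i : ℂ) • pauli i = ((‖c‖ : ℝ) : ℂ) • ((u : QubitOp) * pauli 2 * star (u : QubitOp)) := by
  have hR : c 0 ^ 2 + c 1 ^ 2 + c 2 ^ 2 = ‖c‖ ^ 2 := by
    rw [EuclideanSpace.norm_sq_eq, Fin.sum_univ_three]
    simp
  suffices h : ∃ u : QubitOp, u * star u = 1 ∧
      ∑ i, (c i : ℂ) • pauli i = ((‖c‖ : ℝ) : ℂ) • (u * pauli 2 * star u) by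
    obtain ⟨u, h1, h2⟩ := h
    exact ⟨⟨u, Matrix.mem_unitaryGroup_iff.mpr h1⟩, h2⟩
  rw [pauli_sum_eq]
  generalize c 0 = x at *
  generalize c 1 = y at *
  generalize c 2 = z at *
  have hR0 := norm_nonneg c
  generalize ‖c‖ = R at *
  by_cases h : R + z = 0
  -- Here `c` points along the negative third axis or vanishes, and exchanging the basis vectors
  -- suffices.
  · have hz : z = -R := by linarith
    subst hz
    have hx : x = 0 := by nlinarith
    have hy : y = 0 := by nlinarith
    subst hx hy
    refine ⟨!![0, 1; 1, 0], ?_, ?_⟩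
    · rw [star_fin_two]
      ext i j
      fin_cases i <;> fin_cases j <;> simp
    · rw [star_fin_two]
      ext i j
      fin_cases i <;> fin_cases j <;> simp [pauli]
  · have hzR : -R ≤ z := by nlinarith
    have hp : 0 < R + z := lt_of_le_of_ne (by linarith) (Ne.symm h)
    have hRp : 0 < R := by nlinarith
    have hk : 0 < 2 * R * (R + z) := by positivity
    -- The columns `(R + z, x + iy)` and `(-(x - iy), R + z)` are eigenvectors for `R` and `-R`.
    -- Both have squared norm `2R(R + z)`, and `k` normalizes them.
    obtain ⟨k, hk2⟩ : ∃ k : ℝ, k ^ 2 * (2 * R * (R + z)) = 1 :=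
      ⟨(√(2 * R * (R + z)))⁻¹, by rw [inv_pow, Real.sq_sqrt hk.le, inv_mul_cancel₀ hk.ne']⟩
    have hk2' : (k : ℂ) ^ 2 * (2 * R * (R + z)) = 1 := by exact_mod_cast hk2
    have hRc : (x : ℂ) ^ 2 + y ^ 2 + z ^ 2 = R ^ 2 := by exact_mod_cast hR
    have hI := Complex.I_sq
    refine ⟨!![k * (R + z), -(k * (x - y * Complex.I)); k * (x + y * Complex.I), k * (R + z)],
      ?_, ?_⟩
    · rw [star_fin_two]
      ext i j
      fin_cases i <;> fin_cases j <;> simp <;>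
        clear hk2 hR hR0 h hzR hp hRp hk <;> grind
    · rw [star_fin_two]
      ext i j
      fin_cases i <;> fin_cases j <;> simp [pauli] <;>
        clear hk2 hR hR0 h hzR hp hRp hk <;> grind

/-- Conjugating the reduced state by a unitary thereby becomes a left translation of the Haar
variable. -/
theorem traceSnd_kronecker_mulVec (u : QubitOp) (ψ : Fin 2 × Fin 2 → ℂ) :
    traceSnd (ketBra ((u ⊗ₖ (1 : QubitOp)) *ᵥ ψ)) = u * traceSnd (ketBra ψ) * star u := by
  rw [Matrix.star_eq_conjTranspose]
  ext i j
  simp [traceSnd, ketBra, Matrix.vecMulVec_apply, Matrix.mulVec, dotProduct, Matrix.mul_apply,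
    Fintype.sum_prod_type, Matrix.one_apply]
  ring

theorem trace_traceSnd_ketBra (ψ : Fin 2 × Fin 2 → ℂ) :
    (traceSnd (ketBra ψ)).trace = ((∑ i, ‖ψ i‖ ^ 2 : ℝ) : ℂ) := by
  simp [traceSnd, ketBra, Matrix.vecMulVec_apply, Matrix.trace, Fintype.sum_prod_type,
    Complex.mul_conj']

theorem trace_pauli_two_mul_traceSnd_ketBra (ψ : Fin 2 × Fin 2 → ℂ) :
    (pauli 2 * traceSnd (ketBra ψ)).trace = (zForm ψ : ℂ) := by
  simp only [Matrix.trace_fin_two, Matrix.mul_apply, Fin.sum_univ_two]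
  simp [traceSnd, ketBra, Matrix.vecMulVec_apply, zForm, pauli, Complex.mul_conj']
  ring

theorem mean_observable (c₀ : ℝ) (c : EuclideanSpace ℝ (Fin 3)) (ρ : QubitOp) :
    mean (observable c₀ c) ρ = c₀ * ρ.trace.re + ((∑ i, (c i : ℂ) • pauli i) * ρ).trace.re := by
  simp [mean, observable, add_mul, Matrix.trace_add]

/-- The swap of the two tensor factors. -/
def swapUnitary : PairUnitary :=
  ⟨(Equiv.Perm.permMatrix ℂ (Equiv.prodComm (Fin 2) (Fin 2))), by
    rw [Matrix.mem_unitaryGroup_iff, Matrix.star_eq_conjTranspose, Matrix.conjTranspose_permMatrix,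
      ← Matrix.permMatrix_mul]
    simp⟩

theorem traceSnd_swap (ψ : Fin 2 × Fin 2 → ℂ) :
    traceSnd (ketBra ((swapUnitary : PairOp) *ᵥ ψ)) = traceFst (ketBra ψ) := by
  ext i j
  simp [traceSnd, traceFst, ketBra, swapUnitary, Matrix.vecMulVec_apply, Matrix.permMatrix_mulVec]

theorem continuous_traceSnd_ketBra :
    Continuous fun ψ : Fin 2 × Fin 2 → ℂ => traceSnd (ketBra ψ) := by
  refine continuous_matrix fun i j => ?_
  simp only [traceSnd, ketBra, Matrix.of_apply, Matrix.vecMulVec_apply, Pi.star_apply]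
  fun_prop

@[fun_prop]
theorem continuous_mean (A : QubitOp) : Continuous (mean A) := by
  unfold mean; fun_prop

@[fun_prop]
theorem continuous_uncertainty (A : QubitOp) : Continuous (uncertainty A) := by
  unfold uncertainty; fun_prop

/-- The two partial traces differ by the swap, a unitary absorbed by left invariance. -/
theorem stateMeasure_traceFst (Φ : EuclideanSpace ℂ (Fin 2 × Fin 2)) :
    stateMeasure traceFst Φ = stateMeasure traceSnd Φ := by
  have hc : Continuous fun U : PairUnitary => traceSnd (ketBra ((U : PairOp) *ᵥ Φ.ofLp)) :=
    continuous_traceSnd_ketBra.comp (by fun_prop)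
  have h : (fun U : PairUnitary => traceFst (ketBra ((U : PairOp) *ᵥ Φ.ofLp)))
      = (fun U : PairUnitary => traceSnd (ketBra ((U : PairOp) *ᵥ Φ.ofLp)))
        ∘ fun U => swapUnitary * U := by
    ext1 U
    simp only [Function.comp, ← traceSnd_swap, Matrix.mulVec_mulVec]
    rfl
  unfold stateMeasure
  rw [h, ← Measure.map_map hc.measurable (by fun_prop), map_mul_left_eq_self]

/-- The law of the mean value of a qubit observable. -/
theorem lintegral_mean_observable {h : ℝ → ℝ≥0∞} (hh : Measurable h)
    {Φ : EuclideanSpace ℂ (Fin 2 × Fin 2)} (hΦ : ‖Φ‖ = 1) (c₀ : ℝ) (c : EuclideanSpace ℝ (Fin 3)) :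
    ∫⁻ ρ, h (mean (observable c₀ c) ρ) ∂stateMeasure traceSnd Φ
      = ∫⁻ u : ℝ, ENNReal.ofReal (3 / 4 * (1 - u ^ 2)) * h (c₀ + ‖c‖ * u) := by
  have hc : Continuous fun U : PairUnitary => traceSnd (ketBra ((U : PairOp) *ᵥ Φ.ofLp)) :=
    continuous_traceSnd_ketBra.comp (by fun_prop)
  obtain ⟨u, hu⟩ := exists_unitary_pauli_sum_eq c
  -- Translating by `u* ⊗ 1` moves the diagonalizing unitary from the observable to the state.
  let W : PairUnitary := ⟨(star (u : QubitOp)) ⊗ₖ (1 : QubitOp),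
    Matrix.kronecker_mem_unitary (Unitary.star_mem u.2) (one_mem _)⟩
  unfold stateMeasure
  have hm : Measurable fun ρ => h (mean (observable c₀ c) ρ) :=
    hh.comp (continuous_mean _).measurable
  rw [lintegral_map hm hc.measurable,
    ← lintegral_haar_zForm (h := fun u => h (c₀ + ‖c‖ * u)) (by fun_prop) hΦ,
    ← lintegral_mul_left_eq_self (fun U : PairUnitary =>
      h (c₀ + ‖c‖ * zForm ((U : PairOp) *ᵥ Φ.ofLp))) W]
  refine lintegral_congr fun U => ?_
  congr 1
  have hN : ∑ i, ‖((U : PairOp) *ᵥ Φ.ofLp) i‖ ^ 2 = 1 := by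
    rw [sum_norm_sq_mulVec, ← EuclideanSpace.norm_sq_eq, hΦ, one_pow]
  rw [mean_observable, trace_traceSnd_ketBra, hN, hu]
  have e : ((W * U : PairUnitary) : PairOp) *ᵥ Φ.ofLp
      = (star (u : QubitOp) ⊗ₖ (1 : QubitOp)) *ᵥ ((U : PairOp) *ᵥ Φ.ofLp) := by
    rw [Matrix.mulVec_mulVec]; rfl
  have t := trace_pauli_two_mul_traceSnd_ketBra (((W * U : PairUnitary) : PairOp) *ᵥ Φ.ofLp)
  rw [e, traceSnd_kronecker_mulVec, star_star, ← mul_assoc, Matrix.trace_mul_comm, ← mul_assoc,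
    ← mul_assoc] at t
  rw [e, Matrix.smul_mul, Matrix.trace_smul, t]
  simp

/-! ### Linear marginals of the mean density -/

/-- The area of a half-disc of radius `√m`; for `m ≤ 0` both sides are truncated to zero. -/
theorem lintegral_sqrt_sub_sq (m : ℝ) :
    ∫⁻ y : ℝ, ENNReal.ofReal √(m - y ^ 2) = ENNReal.ofReal (Real.pi / 2 * m) := by
  rcases le_or_gt m 0 with hm | hm
  · rw [ENNReal.ofReal_of_nonpos (by nlinarith [Real.pi_pos])]
    have : ∀ y : ℝ, ENNReal.ofReal √(m - y ^ 2) = 0 := fun y => by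
      rw [Real.sqrt_eq_zero_of_nonpos (by nlinarith [sq_nonneg y]), ENNReal.ofReal_zero]
    simp [this]
  · obtain ⟨r, hr, rfl⟩ : ∃ r : ℝ, 0 < r ∧ r ^ 2 = m :=
      ⟨√m, Real.sqrt_pos.mpr hm, Real.sq_sqrt hm.le⟩
    have h : ∀ y : ℝ, ENNReal.ofReal √(r ^ 2 - y ^ 2)
        = (Set.Icc (-r) r).indicator (fun y => ENNReal.ofReal √(r ^ 2 - y ^ 2)) y := by
      intro y
      by_cases hy : y ∈ Set.Icc (-r) r
      · rw [Set.indicator_of_mem hy]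
      · rw [Set.indicator_of_notMem hy, Real.sqrt_eq_zero_of_nonpos, ENNReal.ofReal_zero]
        by_contra! hlt
        exact hy (abs_le.mp (abs_le_of_sq_le_sq (by linarith) hr.le))
    rw [lintegral_congr h, lintegral_indicator measurableSet_Icc,
      ← ofReal_integral_eq_lintegral_ofReal]
    · rw [integral_Icc_eq_integral_Ioc, ← intervalIntegral.integral_of_le (by linarith)]
      congr 1
      have e : ∀ y : ℝ, √(r ^ 2 - y ^ 2) = r * √(1 - (y / r) ^ 2) := by
        intro y
        rw [← Real.sqrt_sq hr.le, ← Real.sqrt_mul (sq_nonneg _), Real.sqrt_sq hr.le]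
        congr 1
        field_simp
      simp_rw [e]
      rw [intervalIntegral.integral_const_mul,
        intervalIntegral.integral_comp_div (fun t => √(1 - t ^ 2)) hr.ne', neg_div,
        div_self hr.ne', integral_sqrt_one_sub_sq, smul_eq_mul]
      ring
    · exact (by fun_prop : Continuous fun y : ℝ => √(r ^ 2 - y ^ 2)).integrableOn_Icc
    · exact Filter.Eventually.of_forall fun y => Real.sqrt_nonneg _

section Gram

variable {a b : EuclideanSpace ℝ (Fin 3)}

/-- The quadratic form of the inverse Gram matrix. -/
noncomputable def gramForm (a b : EuclideanSpace ℝ (Fin 3)) (x y : ℝ) : ℝ :=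
  (‖b‖ ^ 2 * x ^ 2 - 2 * ⟪a, b⟫ * x * y + ‖a‖ ^ 2 * y ^ 2) / (gramMatrix a b).det

theorem gramMatrix_det (a b : EuclideanSpace ℝ (Fin 3)) :
    (gramMatrix a b).det = ‖a‖ ^ 2 * ‖b‖ ^ 2 - ⟪a, b⟫ ^ 2 := by
  rw [gramMatrix, Matrix.det_fin_two_of, real_inner_self_eq_norm_sq, real_inner_self_eq_norm_sq,
    real_inner_comm a b]
  ring

/-- The vector `|b|² a - ⟨a, b⟩ b` is nonzero by independence, and its squared norm is `|b|² det T`.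
-/
theorem gramMatrix_det_pos (hab : LinearIndependent ℝ ![a, b]) : 0 < (gramMatrix a b).det := by
  have hb : b ≠ 0 := hab.ne_zero 1
  have hb' : 0 < ‖b‖ ^ 2 := by positivity
  have hv : ‖b‖ ^ 2 • a + (-⟪a, b⟫) • b ≠ 0 := fun h =>
    hb'.ne' (LinearIndependent.pair_iff.mp hab _ _ h).1
  have h : ‖‖b‖ ^ 2 • a + (-⟪a, b⟫) • b‖ ^ 2 = ‖b‖ ^ 2 * (gramMatrix a b).det := by
    rw [gramMatrix_det, norm_add_sq_real, norm_smul, norm_smul, real_inner_smul_left,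
      real_inner_smul_right, mul_pow, mul_pow, Real.norm_eq_abs, Real.norm_eq_abs, sq_abs, sq_abs]
    ring
  have : 0 < ‖‖b‖ ^ 2 • a + (-⟪a, b⟫) • b‖ ^ 2 := by positivity
  rw [h] at this
  exact pos_of_mul_pos_right this hb'.le

theorem omega_eq (hab : LinearIndependent ℝ ![a, b]) (a₀ b₀ r s : ℝ) :
    omega a₀ b₀ a b r s = √(gramForm a b (r - a₀) (s - b₀)) := by
  unfold omega gramForm
  congr 1
  have hD := (gramMatrix_det_pos hab).ne'
  rw [Matrix.inv_def, Ring.inverse_eq_inv', Matrix.smul_mulVec, dotProduct_smul, smul_eq_mul,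
    div_eq_inv_mul]
  congr 1
  rw [gramMatrix, Matrix.adjugate_fin_two_of, real_inner_self_eq_norm_sq,
    real_inner_self_eq_norm_sq, real_inner_comm a b]
  simp [Matrix.mulVec, dotProduct, Fin.sum_univ_two]
  ring

/-- Multiplied by `det T`, the difference of the two sides is the square of `|a|² y - ⟨a, b⟩ x`.
Together with its companion this puts the ellipse inside the rectangle `|x| ≤ |a|`, `|y| ≤ |b|`. -/
theorem sq_le_norm_sq_mul_gramForm (hab : LinearIndependent ℝ ![a, b]) (x y : ℝ) :
    x ^ 2 ≤ ‖a‖ ^ 2 * gramForm a b x y := by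
  have hD := gramMatrix_det_pos hab
  rw [gramForm, ← mul_div_assoc, le_div_iff₀ hD, gramMatrix_det]
  nlinarith [sq_nonneg (‖a‖ ^ 2 * y - ⟪a, b⟫ * x)]

theorem sq_le_norm_sq_mul_gramForm' (hab : LinearIndependent ℝ ![a, b]) (x y : ℝ) :
    y ^ 2 ≤ ‖b‖ ^ 2 * gramForm a b x y := by
  have hD := gramMatrix_det_pos hab
  rw [gramForm, ← mul_div_assoc, le_div_iff₀ hD, gramMatrix_det]
  nlinarith [sq_nonneg (‖b‖ ^ 2 * x - ⟪a, b⟫ * y)]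

theorem gramForm_nonneg (hab : LinearIndependent ℝ ![a, b]) (x y : ℝ) : 0 ≤ gramForm a b x y := by
  have ha : 0 < ‖a‖ := norm_pos_iff.mpr (hab.ne_zero 0)
  have := sq_le_norm_sq_mul_gramForm hab x y
  exact nonneg_of_mul_nonneg_right ((sq_nonneg x).trans this) (by positivity)

/-- The Heaviside factor is redundant, since `Real.sqrt` vanishes on negative numbers. -/
theorem meanDensity_add (hab : LinearIndependent ℝ ![a, b]) (a₀ b₀ x y : ℝ) :
    meanDensity a₀ b₀ a b (a₀ + x) (b₀ + y)
      = 3 / (2 * Real.pi * √(gramMatrix a b).det) * √(1 - gramForm a b x y) := by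
  have h0 := gramForm_nonneg hab x y
  rw [meanDensity, omega_eq hab, add_sub_cancel_left, add_sub_cancel_left, Real.sq_sqrt h0,
    heaviside]
  split_ifs with h
  · rw [mul_one]
  · have h1 : 1 < √(gramForm a b x y) := by linarith
    have h2 : 1 - gramForm a b x y ≤ 0 := by nlinarith [Real.sq_sqrt h0]
    rw [mul_zero, Real.sqrt_eq_zero_of_nonpos h2, mul_zero]

theorem measurable_meanDensity (a₀ b₀ : ℝ) (a b : EuclideanSpace ℝ (Fin 3)) :
    Measurable fun p : ℝ × ℝ => meanDensity a₀ b₀ a b p.1 p.2 := by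
  have h : Measurable fun p : ℝ × ℝ => omega a₀ b₀ a b p.1 p.2 := by
    unfold omega
    simp only [Matrix.mulVec, dotProduct, Fin.sum_univ_two, Matrix.cons_val_zero,
      Matrix.cons_val_one]
    fun_prop
  have h' : Measurable heaviside :=
    Measurable.ite measurableSet_Ici measurable_const measurable_const
  unfold meanDensity
  fun_prop

/-- The vectors `T(α, β) / c` and `s (β, -α) / c` are orthonormal for the form of `T⁻¹`. Here `A`,
`B`, `C` are the entries of `T`, and `s² = det T`. -/
theorem orthogonal_coordinates_identity {A B C s c α β : ℝ} (hs2 : s ^ 2 = A * B - C ^ 2)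
    (hc : c ≠ 0) (hc2 : c ^ 2 = α ^ 2 * A + 2 * α * β * C + β ^ 2 * B) (u v : ℝ) :
    B * ((α * A + β * C) / c * u + β * s / c * v) ^ 2
        - 2 * C * ((α * A + β * C) / c * u + β * s / c * v)
          * ((α * C + β * B) / c * u + -(α * s) / c * v)
        + A * ((α * C + β * B) / c * u + -(α * s) / c * v) ^ 2
      = (u ^ 2 + v ^ 2) * (A * B - C ^ 2) := by
  have h : ∀ x y : ℝ, B * (x / c) ^ 2 - 2 * C * (x / c) * (y / c) + A * (y / c) ^ 2
      = (B * x ^ 2 - 2 * C * x * y + A * y ^ 2) / c ^ 2 := fun x y => by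
    field_simp
  have e1 : (α * A + β * C) / c * u + β * s / c * v = ((α * A + β * C) * u + β * s * v) / c := by
    ring
  have e2 : (α * C + β * B) / c * u + -(α * s) / c * v
      = ((α * C + β * B) * u - α * s * v) / c := by ring
  rw [e1, e2, h, div_eq_iff (pow_ne_zero 2 hc), hc2]
  linear_combination (v ^ 2 * (α ^ 2 * A + 2 * α * β * C + β ^ 2 * B)) * hs2

/-- Linear coordinates in which the Gram form is Euclidean and a given linear form depends on the
first coordinate only. -/
theorem exists_orthogonal_coordinates (hab : LinearIndependent ℝ ![a, b]) {α β : ℝ}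
    (hαβ : ¬(α = 0 ∧ β = 0)) :
    ∃ L : ℝ × ℝ →ₗ[ℝ] ℝ × ℝ, LinearMap.det L = -√(gramMatrix a b).det ∧
      ∀ z, gramForm a b (L z).1 (L z).2 = z.1 ^ 2 + z.2 ^ 2 ∧
        α * (L z).1 + β * (L z).2 = ‖α • a + β • b‖ * z.1 := by
  have hD := gramMatrix_det_pos hab
  have hs2 : √(gramMatrix a b).det ^ 2 = (gramMatrix a b).det := Real.sq_sqrt hD.le
  have hc : ‖α • a + β • b‖ ≠ 0 := by
    rw [norm_ne_zero_iff]
    exact fun h => hαβ (LinearIndependent.pair_iff.mp hab _ _ h)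
  have hc2 : ‖α • a + β • b‖ ^ 2
      = α ^ 2 * ‖a‖ ^ 2 + 2 * α * β * ⟪a, b⟫ + β ^ 2 * ‖b‖ ^ 2 := by
    rw [norm_add_sq_real, norm_smul, norm_smul, real_inner_smul_left,
      real_inner_smul_right, mul_pow, mul_pow, Real.norm_eq_abs, Real.norm_eq_abs, sq_abs, sq_abs]
    ring
  have hDe := gramMatrix_det a b
  unfold gramForm
  generalize (gramMatrix a b).det = D at *
  generalize ‖α • a + β • b‖ = c at *
  generalize ‖a‖ ^ 2 = A at *
  generalize ‖b‖ ^ 2 = B at *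
  generalize ⟪a, b⟫ = C at *
  generalize √D = s at *
  -- The second column is proportional to `(β, -α)`, so the linear form `(α, β)` annihilates it.
  refine ⟨Matrix.toLin (Module.Basis.finTwoProd ℝ) (Module.Basis.finTwoProd ℝ)
    !![(α * A + β * C) / c, β * s / c; (α * C + β * B) / c, -(α * s) / c], ?_, fun z => ?_⟩
  · rw [LinearMap.det_toLin, Matrix.det_fin_two_of]
    have e : (α * A + β * C) / c * (-(α * s) / c) - β * s / c * ((α * C + β * B) / c)
        = -s * (α ^ 2 * A + 2 * α * β * C + β ^ 2 * B) / c ^ 2 := by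
      field_simp
      ring
    rw [e, ← hc2, mul_div_cancel_right₀ _ (pow_ne_zero 2 hc)]
  · rw [Matrix.toLin_finTwoProd_apply]
    constructor
    · rw [div_eq_iff hD.ne', hDe]
      exact orthogonal_coordinates_identity (hs2.trans hDe) hc hc2 z.1 z.2
    · have e : α * ((α * A + β * C) / c * z.1 + β * s / c * z.2)
          + β * ((α * C + β * B) / c * z.1 + -(α * s) / c * z.2)
          = (α ^ 2 * A + 2 * α * β * C + β ^ 2 * B) * z.1 / c := by
        ring
      rw [e, ← hc2, div_eq_iff hc]
      ring

/-- The law of a linear combination of two variables with joint density `meanDensity`. -/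
theorem lintegral_meanDensity_linear (hab : LinearIndependent ℝ ![a, b]) (a₀ b₀ : ℝ)
    {h : ℝ → ℝ≥0∞} (hh : Measurable h) {α β : ℝ} (hαβ : ¬(α = 0 ∧ β = 0)) :
    ∫⁻ p : ℝ × ℝ, ENNReal.ofReal (meanDensity a₀ b₀ a b p.1 p.2) * h (α * p.1 + β * p.2)
      = ∫⁻ u : ℝ, ENNReal.ofReal (3 / 4 * (1 - u ^ 2)) *
          h (α * a₀ + β * b₀ + ‖α • a + β • b‖ * u) := by
  obtain ⟨L, hdet, hL⟩ := exists_orthogonal_coordinates hab hαβ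
  have hs : 0 < √(gramMatrix a b).det := Real.sqrt_pos.mpr (gramMatrix_det_pos hab)
  have hdet0 : LinearMap.det L ≠ 0 := by rw [hdet]; exact neg_ne_zero.mpr hs.ne'
  have hLm : Measurable L := (LinearMap.continuous_of_finiteDimensional L).measurable
  have hfm : Measurable fun p : ℝ × ℝ =>
      ENNReal.ofReal (meanDensity a₀ b₀ a b p.1 p.2) * h (α * p.1 + β * p.2) :=
    (measurable_meanDensity a₀ b₀ a b).ennreal_ofReal.mul (by fun_prop)
  have htm : Measurable fun p : ℝ × ℝ => ((a₀, b₀) : ℝ × ℝ) + p := by fun_prop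
  have hchange : ∀ f : ℝ × ℝ → ℝ≥0∞, Measurable f →
      ∫⁻ p, f p = ENNReal.ofReal √(gramMatrix a b).det * ∫⁻ z, f (L z) := by
    intro f hf
    have hmap := Measure.map_linearMap_addHaar_eq_smul_addHaar (volume : Measure (ℝ × ℝ)) hdet0
    rw [← lintegral_map hf hLm, hmap, lintegral_smul_measure, smul_eq_mul, ← mul_assoc,
      ← ENNReal.ofReal_mul hs.le, hdet, abs_inv, abs_neg, abs_of_pos hs, mul_inv_cancel₀ hs.ne',
      ENNReal.ofReal_one, one_mul]
  rw [← lintegral_add_left_eq_self _ ((a₀, b₀) : ℝ × ℝ)]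
  refine (hchange _ (hfm.comp htm)).trans ?_
  have hpt : ∀ z : ℝ × ℝ, ENNReal.ofReal
          (meanDensity a₀ b₀ a b (((a₀, b₀) : ℝ × ℝ) + L z).1 (((a₀, b₀) : ℝ × ℝ) + L z).2) *
        h (α * (((a₀, b₀) : ℝ × ℝ) + L z).1 + β * (((a₀, b₀) : ℝ × ℝ) + L z).2)
      = ENNReal.ofReal (3 / (2 * Real.pi * √(gramMatrix a b).det)) *
          (h (α * a₀ + β * b₀ + ‖α • a + β • b‖ * z.1) *
          ENNReal.ofReal √((1 - z.1 ^ 2) - z.2 ^ 2)) := by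
    intro z
    have hlin : α * (a₀ + (L z).1) + β * (b₀ + (L z).2)
        = α * a₀ + β * b₀ + ‖α • a + β • b‖ * z.1 := by
      rw [← (hL z).2]
      ring
    simp only [Prod.fst_add, Prod.snd_add]
    rw [meanDensity_add hab, (hL z).1, hlin, ENNReal.ofReal_mul (by positivity), sub_sub]
    ring
  refine (congrArg _ (lintegral_congr hpt)).trans ?_
  rw [lintegral_const_mul _ (by fun_prop), ← mul_assoc,
    ← ENNReal.ofReal_mul hs.le, Measure.volume_eq_prod, lintegral_prod _ (by fun_prop),
    ← lintegral_const_mul _ (by fun_prop)]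
  refine lintegral_congr fun u => ?_
  simp only
  -- The half-disc area `π/2 (1 - u²)` meets the constant `3 / (2π)`, whose factor `√(det T)` the
  -- Jacobian has cancelled; the result is `3/4 (1 - u²)`.
  rw [lintegral_const_mul _ (by fun_prop), lintegral_sqrt_sub_sq, mul_left_comm,
    ← ENNReal.ofReal_mul (by positivity), mul_comm]
  congr 2
  field_simp
  ring

end Gram

/-! ### Folding along `x ↦ √(R² - x²)` -/

/-- Folding the interval `(-R, R)` along `x ↦ √(R² - x²)`. -/
theorem lintegral_comp_sqrt_sub_sq {R : ℝ} (hR : 0 < R) {f : ℝ → ℝ → ℝ≥0∞}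
    (hf : Measurable (Function.uncurry f)) (h0 : ∀ x t, R ≤ |x| → f x t = 0) :
    ∫⁻ x, f x √(R ^ 2 - x ^ 2) = ∫⁻ x in Set.Ioo 0 R, ENNReal.ofReal (x / √(R ^ 2 - x ^ 2)) *
      (f √(R ^ 2 - x ^ 2) x + f (-√(R ^ 2 - x ^ 2)) x) := by
  have hpos : ∀ x ∈ Set.Ioo 0 R, 0 < R ^ 2 - x ^ 2 := fun x hx => by nlinarith [hx.1, hx.2]
  -- The map is an involution of `(0, R)`, hence a bijection of it.
  have hinv : ∀ x ∈ Set.Ioo 0 R, √(R ^ 2 - √(R ^ 2 - x ^ 2) ^ 2) = x := fun x hx => by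
    rw [Real.sq_sqrt (hpos x hx).le, sub_sub_cancel, Real.sqrt_sq hx.1.le]
  have hmem : ∀ x ∈ Set.Ioo 0 R, √(R ^ 2 - x ^ 2) ∈ Set.Ioo 0 R := fun x hx =>
    ⟨Real.sqrt_pos.mpr (hpos x hx), by
      rw [Real.sqrt_lt' hR]
      have := hx.1
      nlinarith⟩
  have himg : (fun x => √(R ^ 2 - x ^ 2)) '' Set.Ioo 0 R = Set.Ioo 0 R := by
    ext t
    constructor
    · rintro ⟨x, hx, rfl⟩
      exact hmem x hx
    · exact fun ht => ⟨_, hmem t ht, hinv t ht⟩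
  have hinj : Set.InjOn (fun x => √(R ^ 2 - x ^ 2)) (Set.Ioo 0 R) := fun x hx y hy hxy => by
    simp only at hxy
    rw [← hinv x hx, hxy, hinv y hy]
  have hder : ∀ x ∈ Set.Ioo 0 R, HasDerivWithinAt (fun x => √(R ^ 2 - x ^ 2))
      (-x / √(R ^ 2 - x ^ 2)) (Set.Ioo 0 R) x := by
    intro x hx
    have h := (((hasDerivAt_pow 2 x).const_sub (R ^ 2)).sqrt (hpos x hx).ne').hasDerivWithinAt
      (s := Set.Ioo 0 R)
    refine h.congr_deriv ?_
    field_simp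
    simp
  have fold : ∀ g : ℝ → ℝ≥0∞, ∫⁻ x in Set.Ioo 0 R, g x
      = ∫⁻ x in Set.Ioo 0 R, ENNReal.ofReal (x / √(R ^ 2 - x ^ 2)) * g √(R ^ 2 - x ^ 2) := by
    intro g
    nth_rewrite 1 [← himg]
    rw [lintegral_image_eq_lintegral_abs_deriv_mul measurableSet_Ioo hder hinj]
    refine setLIntegral_congr_fun measurableSet_Ioo fun x hx => ?_
    have := hx.1
    rw [neg_div, abs_neg, abs_of_nonneg (by positivity)]
  have hm1 : Measurable fun x => f x √(R ^ 2 - x ^ 2) :=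
    hf.comp (by fun_prop : Measurable fun x : ℝ => (x, √(R ^ 2 - x ^ 2)))
  have hneg : ∫⁻ x in Set.Iio 0, f x √(R ^ 2 - x ^ 2)
      = ∫⁻ x in Set.Ioi 0, f (-x) √(R ^ 2 - x ^ 2) := by
    rw [← lintegral_indicator measurableSet_Iio, ← lintegral_indicator measurableSet_Ioi,
      ← lintegral_neg_eq_self]
    refine lintegral_congr fun x => ?_
    simp [Set.indicator]
  have hrestr : ∀ g : ℝ → ℝ≥0∞, (∀ x, R ≤ |x| → g x = 0) →
      ∫⁻ x in Set.Ioi 0, g x = ∫⁻ x in Set.Ioo 0 R, g x := by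
    intro g hg
    rw [← lintegral_indicator measurableSet_Ioi, ← lintegral_indicator measurableSet_Ioo]
    refine lintegral_congr fun x => ?_
    simp only [Set.indicator, Set.mem_Ioi, Set.mem_Ioo]
    by_cases hx : 0 < x
    · by_cases hxR : x < R
      · simp [hx, hxR]
      · simp [hx, hxR, hg x (by rw [abs_of_pos hx]; exact not_lt.mp hxR)]
    · simp [hx]
  have hsplit : ∫⁻ x, f x √(R ^ 2 - x ^ 2)
      = ∫⁻ x in Set.Ioi 0, (f x √(R ^ 2 - x ^ 2) + f (-x) √(R ^ 2 - x ^ 2)) := by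
    rw [lintegral_add_left hm1, ← hneg, ← lintegral_add_compl _ (measurableSet_Ioi (a := (0 : ℝ))),
      Set.compl_Ioi, setLIntegral_congr Iio_ae_eq_Iic]
  rw [hsplit, hrestr _ fun x hx => by rw [h0 _ _ hx, h0 _ _ (by rwa [abs_neg]), add_zero], fold]
  refine setLIntegral_congr_fun measurableSet_Ioo fun x hx => ?_
  simp only [hinv x hx]

/-- The one-variable folding is applied in `y` for fixed `x`, then in `x`; two signs in each
variable make four branches. -/
theorem lintegral_lintegral_comp_sqrt_sub_sq {R S : ℝ} (hR : 0 < R) (hS : 0 < S)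
    {f : ℝ → ℝ → ℝ≥0∞} (hf : Measurable (Function.uncurry f))
    (hfx : ∀ x y, R ≤ |x| → f x y = 0) (hfy : ∀ x y, S ≤ |y| → f x y = 0)
    {h : ℝ × ℝ → ℝ≥0∞} (hh : Measurable h) :
    ∫⁻ x, ∫⁻ y, f x y * h (√(R ^ 2 - x ^ 2), √(S ^ 2 - y ^ 2))
      = ∫⁻ x in Set.Ioo 0 R, ∫⁻ y in Set.Ioo 0 S,
        ENNReal.ofReal (x / √(R ^ 2 - x ^ 2)) * ENNReal.ofReal (y / √(S ^ 2 - y ^ 2)) *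
          (f √(R ^ 2 - x ^ 2) √(S ^ 2 - y ^ 2) + f √(R ^ 2 - x ^ 2) (-√(S ^ 2 - y ^ 2))
            + f (-√(R ^ 2 - x ^ 2)) √(S ^ 2 - y ^ 2)
            + f (-√(R ^ 2 - x ^ 2)) (-√(S ^ 2 - y ^ 2))) * h (x, y) := by
  have hp : Measurable fun q : (ℝ × ℝ) × ℝ => f q.1.1 √(S ^ 2 - q.2 ^ 2) :=
    hf.comp (by fun_prop : Measurable fun q : (ℝ × ℝ) × ℝ => (q.1.1, √(S ^ 2 - q.2 ^ 2)))
  have hn : Measurable fun q : (ℝ × ℝ) × ℝ => f q.1.1 (-√(S ^ 2 - q.2 ^ 2)) :=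
    hf.comp (by fun_prop : Measurable fun q : (ℝ × ℝ) × ℝ => (q.1.1, -√(S ^ 2 - q.2 ^ 2)))
  have hG : Measurable fun q : (ℝ × ℝ) × ℝ => ENNReal.ofReal (q.2 / √(S ^ 2 - q.2 ^ 2)) *
      (f q.1.1 √(S ^ 2 - q.2 ^ 2) * h (q.1.2, q.2)
        + f q.1.1 (-√(S ^ 2 - q.2 ^ 2)) * h (q.1.2, q.2)) := by fun_prop
  have hGm : ∀ s t : ℝ, Measurable fun y : ℝ => ENNReal.ofReal (y / √(S ^ 2 - y ^ 2)) *
      (f s √(S ^ 2 - y ^ 2) * h (t, y) + f s (-√(S ^ 2 - y ^ 2)) * h (t, y)) := fun s t =>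
    hG.comp (by fun_prop : Measurable fun y : ℝ => ((s, t), y))
  have inner_eq : ∀ x t, ∫⁻ y, f x y * h (t, √(S ^ 2 - y ^ 2)) = ∫⁻ y in Set.Ioo 0 S,
      ENNReal.ofReal (y / √(S ^ 2 - y ^ 2)) *
        (f x √(S ^ 2 - y ^ 2) * h (t, y) + f x (-√(S ^ 2 - y ^ 2)) * h (t, y)) := by
    intro x t
    have m : Measurable fun p : ℝ × ℝ => f x p.1 :=
      hf.comp (by fun_prop : Measurable fun p : ℝ × ℝ => (x, p.1))
    exact lintegral_comp_sqrt_sub_sq hS (f := fun y u => f x y * h (t, u))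
      (by unfold Function.uncurry; fun_prop) fun y u hy => by rw [hfy x y hy, zero_mul]
  simp_rw [inner_eq]
  rw [lintegral_comp_sqrt_sub_sq hR (f := fun x t => ∫⁻ y in Set.Ioo 0 S,
      ENNReal.ofReal (y / √(S ^ 2 - y ^ 2)) *
        (f x √(S ^ 2 - y ^ 2) * h (t, y) + f x (-√(S ^ 2 - y ^ 2)) * h (t, y)))
    (Measurable.lintegral_prod_right' hG)
    (fun x t hx => by simp [hfx x _ hx])]
  refine lintegral_congr fun x => ?_
  rw [← lintegral_add_left (hGm _ _)]
  refine (lintegral_const_mul _ ((hGm _ _).add (hGm _ _))).symm.trans (lintegral_congr fun y => ?_)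
  simp only [Pi.add_apply]
  ring

/-! ### From the mean density to the uncertainty density -/

theorem meanDensity_nonneg (a₀ b₀ : ℝ) (a b : EuclideanSpace ℝ (Fin 3)) (r s : ℝ) :
    0 ≤ meanDensity a₀ b₀ a b r s := by
  have : 0 ≤ heaviside (1 - omega a₀ b₀ a b r s) := by
    unfold heaviside
    split_ifs <;> norm_num
  unfold meanDensity
  positivity

theorem meanDensity_eq_zero {a b : EuclideanSpace ℝ (Fin 3)} (hab : LinearIndependent ℝ ![a, b])
    (a₀ b₀ : ℝ) {x y : ℝ} (h : ‖a‖ ≤ |x| ∨ ‖b‖ ≤ |y|) :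
    meanDensity a₀ b₀ a b (a₀ + x) (b₀ + y) = 0 := by
  have ha : 0 < ‖a‖ := norm_pos_iff.mpr (hab.ne_zero 0)
  have hb : 0 < ‖b‖ := norm_pos_iff.mpr (hab.ne_zero 1)
  have hQ : 1 ≤ gramForm a b x y := by
    rcases h with h | h
    · have h1 : ‖a‖ ^ 2 ≤ x ^ 2 := by rw [← sq_abs x]; gcongr
      have h2 := sq_le_norm_sq_mul_gramForm hab x y
      exact le_of_mul_le_mul_left (a := ‖a‖ ^ 2) (by linarith) (by positivity)
    · have h1 : ‖b‖ ^ 2 ≤ y ^ 2 := by rw [← sq_abs y]; gcongr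
      have h2 := sq_le_norm_sq_mul_gramForm' hab x y
      exact le_of_mul_le_mul_left (a := ‖b‖ ^ 2) (by linarith) (by positivity)
  have hQ' : 1 - gramForm a b x y ≤ 0 := by linarith
  rw [meanDensity_add hab, Real.sqrt_eq_zero_of_nonpos hQ', mul_zero]

theorem meanDensity_neg {a b : EuclideanSpace ℝ (Fin 3)} (hab : LinearIndependent ℝ ![a, b])
    (a₀ b₀ x y : ℝ) :
    meanDensity a₀ b₀ a b (a₀ + -x) (b₀ + -y) = meanDensity a₀ b₀ a b (a₀ + x) (b₀ + y) := by
  have h : gramForm a b (-x) (-y) = gramForm a b x y := by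
    unfold gramForm
    ring
  rw [meanDensity_add hab, meanDensity_add hab, h]

theorem measurable_uncertaintyDensity (a₀ b₀ : ℝ) (a b : EuclideanSpace ℝ (Fin 3)) :
    Measurable fun p : ℝ × ℝ => uncertaintyDensity a₀ b₀ a b p.1 p.2 := by
  have hmd := measurable_meanDensity a₀ b₀ a b
  unfold uncertaintyDensity
  generalize meanDensity a₀ b₀ a b = f at *
  generalize ‖a‖ = R
  generalize ‖b‖ = S
  have hs : MeasurableSet {p : ℝ × ℝ | (0 ≤ p.1 ∧ p.1 < R) ∧ (0 ≤ p.2 ∧ p.2 < S)} :=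
    (measurableSet_Ico (a := (0 : ℝ)) (b := R)).prod (measurableSet_Ico (a := (0 : ℝ)) (b := S))
  have m1 : Measurable fun p : ℝ × ℝ => f (a₀ + √(R ^ 2 - p.1 ^ 2)) (b₀ + √(S ^ 2 - p.2 ^ 2)) :=
    hmd.comp (by fun_prop : Measurable fun p : ℝ × ℝ =>
      (a₀ + √(R ^ 2 - p.1 ^ 2), b₀ + √(S ^ 2 - p.2 ^ 2)))
  have m2 : Measurable fun p : ℝ × ℝ => f (a₀ + √(R ^ 2 - p.1 ^ 2)) (b₀ - √(S ^ 2 - p.2 ^ 2)) :=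
    hmd.comp (by fun_prop : Measurable fun p : ℝ × ℝ =>
      (a₀ + √(R ^ 2 - p.1 ^ 2), b₀ - √(S ^ 2 - p.2 ^ 2)))
  exact Measurable.ite hs (by fun_prop) measurable_const

/-- On the edges `x = 0` and `y = 0` the factor `x * y` vanishes, so open intervals suffice. -/
theorem uncertaintyDensity_eq_zero (a₀ b₀ : ℝ) (a b : EuclideanSpace ℝ (Fin 3)) {x y : ℝ}
    (h : x ∉ Set.Ioo 0 ‖a‖ ∨ y ∉ Set.Ioo 0 ‖b‖) : uncertaintyDensity a₀ b₀ a b x y = 0 := by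
  rw [uncertaintyDensity]
  split_ifs with hc
  · have : x = 0 ∨ y = 0 := by
      by_contra! hne
      rcases h with h | h
      · exact h ⟨lt_of_le_of_ne hc.1.1 hne.1.symm, hc.1.2⟩
      · exact h ⟨lt_of_le_of_ne hc.2.1 hne.2.symm, hc.2.2⟩
    rcases this with rfl | rfl <;> simp
  · rfl

/-- Evenness of the Gram form pairs the four branches: this accounts for the factor 2 and for the
choice of `r₊` alone. -/
theorem ofReal_uncertaintyDensity {a b : EuclideanSpace ℝ (Fin 3)}
    (hab : LinearIndependent ℝ ![a, b]) (a₀ b₀ : ℝ) {x y : ℝ} (hx : x ∈ Set.Ioo 0 ‖a‖)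
    (hy : y ∈ Set.Ioo 0 ‖b‖) {f : ℝ → ℝ → ℝ≥0∞}
    (hf : ∀ s t, f s t = ENNReal.ofReal (meanDensity a₀ b₀ a b (a₀ + s) (b₀ + t))) :
    ENNReal.ofReal (uncertaintyDensity a₀ b₀ a b x y)
      = ENNReal.ofReal (x / √(‖a‖ ^ 2 - x ^ 2)) * ENNReal.ofReal (y / √(‖b‖ ^ 2 - y ^ 2)) *
          (f √(‖a‖ ^ 2 - x ^ 2) √(‖b‖ ^ 2 - y ^ 2) + f √(‖a‖ ^ 2 - x ^ 2) (-√(‖b‖ ^ 2 - y ^ 2))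
            + f (-√(‖a‖ ^ 2 - x ^ 2)) √(‖b‖ ^ 2 - y ^ 2)
            + f (-√(‖a‖ ^ 2 - x ^ 2)) (-√(‖b‖ ^ 2 - y ^ 2))) := by
  have hx0 := hx.1
  have hy0 := hy.1
  have hX : 0 < ‖a‖ ^ 2 - x ^ 2 := by nlinarith [hx.2]
  rw [uncertaintyDensity, if_pos ⟨⟨hx.1.le, hx.2⟩, hy.1.le, hy.2⟩, Real.sqrt_mul hX.le,
    sub_eq_add_neg b₀]
  set s := √(‖a‖ ^ 2 - x ^ 2) with hs
  set t := √(‖b‖ ^ 2 - y ^ 2) with ht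
  have hs0 : 0 ≤ s := Real.sqrt_nonneg _
  have ht0 : 0 ≤ t := Real.sqrt_nonneg _
  have h1 : f (-s) (-t) = f s t := by rw [hf, hf, meanDensity_neg hab]
  have h2 : f (-s) t = f s (-t) := by
    have := meanDensity_neg hab a₀ b₀ s (-t)
    rw [neg_neg] at this
    rw [hf, hf, this]
  have hval : ∀ u v : ℝ, 2 * x * y * (u + v) / (s * t) = (x / s) * (y / t) * (2 * (u + v)) := by
    intro u v
    rw [div_mul_div_comm]
    ring
  rw [h1, h2, hf, hf, hval, ENNReal.ofReal_mul (by positivity), ENNReal.ofReal_mul (by positivity),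
    ENNReal.ofReal_mul zero_le_two,
    ENNReal.ofReal_add (meanDensity_nonneg _ _ _ _ _ _) (meanDensity_nonneg _ _ _ _ _ _),
    ENNReal.ofReal_ofNat]
  ring

theorem lintegral_uncertaintyDensity {a b : EuclideanSpace ℝ (Fin 3)}
    (hab : LinearIndependent ℝ ![a, b]) (a₀ b₀ : ℝ) {h : ℝ × ℝ → ℝ≥0∞} (hh : Measurable h) :
    ∫⁻ p : ℝ × ℝ, ENNReal.ofReal (meanDensity a₀ b₀ a b p.1 p.2) *
        h (√(‖a‖ ^ 2 - (p.1 - a₀) ^ 2), √(‖b‖ ^ 2 - (p.2 - b₀) ^ 2))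
      = ∫⁻ p : ℝ × ℝ, ENNReal.ofReal (uncertaintyDensity a₀ b₀ a b p.1 p.2) * h p := by
  have ha : 0 < ‖a‖ := norm_pos_iff.mpr (hab.ne_zero 0)
  have hb : 0 < ‖b‖ := norm_pos_iff.mpr (hab.ne_zero 1)
  obtain ⟨f, hf⟩ : ∃ f : ℝ → ℝ → ℝ≥0∞, ∀ s t,
      f s t = ENNReal.ofReal (meanDensity a₀ b₀ a b (a₀ + s) (b₀ + t)) := ⟨_, fun _ _ => rfl⟩
  have hfm : Measurable (Function.uncurry f) := by
    have : Function.uncurry f = fun p : ℝ × ℝ =>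
        ENNReal.ofReal (meanDensity a₀ b₀ a b (a₀ + p.1) (b₀ + p.2)) := funext fun p => hf _ _
    rw [this]
    exact ((measurable_meanDensity a₀ b₀ a b).comp
      (by fun_prop : Measurable fun p : ℝ × ℝ => (a₀ + p.1, b₀ + p.2))).ennreal_ofReal
  have hm0 : Measurable fun p : ℝ × ℝ =>
      f p.1 p.2 * h (√(‖a‖ ^ 2 - p.1 ^ 2), √(‖b‖ ^ 2 - p.2 ^ 2)) := by
    have : Measurable fun p : ℝ × ℝ => f p.1 p.2 := hfm
    fun_prop
  have e1 : ∫⁻ p : ℝ × ℝ, ENNReal.ofReal (meanDensity a₀ b₀ a b p.1 p.2) *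
        h (√(‖a‖ ^ 2 - (p.1 - a₀) ^ 2), √(‖b‖ ^ 2 - (p.2 - b₀) ^ 2))
      = ∫⁻ x, ∫⁻ y, f x y * h (√(‖a‖ ^ 2 - x ^ 2), √(‖b‖ ^ 2 - y ^ 2)) := by
    rw [← lintegral_add_left_eq_self _ ((a₀, b₀) : ℝ × ℝ), Measure.volume_eq_prod,
      ← lintegral_prod _ hm0.aemeasurable]
    refine lintegral_congr fun p => ?_
    simp only [Prod.fst_add, Prod.snd_add, add_sub_cancel_left, hf]
  have hum := (measurable_uncertaintyDensity a₀ b₀ a b).ennreal_ofReal.mul hh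
  rw [e1, lintegral_lintegral_comp_sqrt_sub_sq ha hb hfm
    (fun x y hx => by rw [hf, meanDensity_eq_zero hab _ _ (Or.inl hx), ENNReal.ofReal_zero])
    (fun x y hy => by rw [hf, meanDensity_eq_zero hab _ _ (Or.inr hy), ENNReal.ofReal_zero]) hh,
    Measure.volume_eq_prod]
  refine Eq.trans ?_ (lintegral_prod _ hum.aemeasurable).symm
  rw [← lintegral_indicator measurableSet_Ioo]
  refine lintegral_congr fun x => ?_
  by_cases hx : x ∈ Set.Ioo 0 ‖a‖
  · rw [Set.indicator_of_mem hx, ← lintegral_indicator measurableSet_Ioo]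
    refine lintegral_congr fun y => ?_
    by_cases hy : y ∈ Set.Ioo 0 ‖b‖
    · rw [Set.indicator_of_mem hy, ← ofReal_uncertaintyDensity hab a₀ b₀ hx hy hf]
      rfl
    · rw [Set.indicator_of_notMem hy]
      simp [uncertaintyDensity_eq_zero a₀ b₀ a b (Or.inr hy)]
  · rw [Set.indicator_of_notMem hx]
    simp [uncertaintyDensity_eq_zero a₀ b₀ a b (Or.inl hx)]

/-! ### Uncertainties as functions of the means -/

theorem pauli_sum_sq (c : EuclideanSpace ℝ (Fin 3)) :
    (∑ i, (c i : ℂ) • pauli i) ^ 2 = ((‖c‖ ^ 2 : ℝ) : ℂ) • (1 : QubitOp) := by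
  have hR : ‖c‖ ^ 2 = c 0 ^ 2 + c 1 ^ 2 + c 2 ^ 2 := by
    rw [EuclideanSpace.norm_sq_eq, Fin.sum_univ_three]
    simp
  have hI := Complex.I_sq
  rw [pauli_sum_eq, hR, sq]
  ext i j
  fin_cases i <;> fin_cases j <;> simp <;> grind

/-- As `(c · σ)² = |c|²`, the square of the observable is `(c₀² + |c|²) 𝟙 + 2c₀ c · σ`, whose mean
is affine in the mean of the observable. -/
theorem uncertainty_observable (c₀ : ℝ) (c : EuclideanSpace ℝ (Fin 3)) {ρ : QubitOp}
    (hρ : ρ.trace.re = 1) :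
    uncertainty (observable c₀ c) ρ = √(‖c‖ ^ 2 - (mean (observable c₀ c) ρ - c₀) ^ 2) := by
  have h : mean (observable c₀ c ^ 2) ρ
      = c₀ ^ 2 + ‖c‖ ^ 2 + 2 * c₀ * (mean (observable c₀ c) ρ - c₀) := by
    rw [mean_observable, hρ]
    have e : observable c₀ c ^ 2 = ((c₀ ^ 2 + ‖c‖ ^ 2 : ℝ) : ℂ) • (1 : QubitOp)
        + ((2 * c₀ : ℝ) : ℂ) • ∑ i, (c i : ℂ) • pauli i := by
      have := pauli_sum_sq c
      rw [sq] at this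
      rw [observable, sq, add_mul, mul_add, mul_add, this]
      simp only [smul_mul_assoc, mul_smul_comm, one_mul, mul_one, smul_smul]
      push_cast
      module
    rw [mean, e, add_mul, Matrix.trace_add, smul_mul_assoc, smul_mul_assoc, one_mul,
      Matrix.trace_smul, Matrix.trace_smul, smul_eq_mul, smul_eq_mul, Complex.add_re,
      Complex.re_ofReal_mul, Complex.re_ofReal_mul, hρ]
    ring
  rw [uncertainty, h]
  congr 1
  ring

/-! ### The joint laws -/

theorem stateMeasure_eq_traceSnd {tr : PairOp → QubitOp} (htr : tr = traceFst ∨ tr = traceSnd)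
    (Φ : EuclideanSpace ℂ (Fin 2 × Fin 2)) : stateMeasure tr Φ = stateMeasure traceSnd Φ := by
  rcases htr with rfl | rfl
  · exact stateMeasure_traceFst Φ
  · rfl

theorem measurable_traceSnd_orbit (Φ : EuclideanSpace ℂ (Fin 2 × Fin 2)) :
    Measurable fun U : PairUnitary => traceSnd (ketBra ((U : PairOp) *ᵥ Φ.ofLp)) :=
  (continuous_traceSnd_ketBra.comp
    (by fun_prop : Continuous fun U : PairUnitary => (U : PairOp) *ᵥ Φ.ofLp)).measurable

instance (Φ : EuclideanSpace ℂ (Fin 2 × Fin 2)) :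
    IsProbabilityMeasure (stateMeasure traceSnd Φ) :=
  Measure.isProbabilityMeasure_map (measurable_traceSnd_orbit Φ).aemeasurable

theorem ae_trace_eq_one {Φ : EuclideanSpace ℂ (Fin 2 × Fin 2)} (hΦ : ‖Φ‖ = 1) :
    ∀ᵐ ρ ∂stateMeasure traceSnd Φ, ρ.trace.re = 1 := by
  have hc : Continuous fun ρ : QubitOp => ρ.trace.re := by fun_prop
  refine (ae_map_iff (measurable_traceSnd_orbit Φ).aemeasurable
    (isClosed_eq hc continuous_const).measurableSet).mpr (Filter.Eventually.of_forall fun U => ?_)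
  rw [trace_traceSnd_ketBra, sum_norm_sq_mulVec, ← EuclideanSpace.norm_sq_eq, hΦ]
  simp

/-- Cramér–Wold: both measures have the same image under every linear functional, hence the same
characteristic function. -/
theorem map_mean_eq (a₀ b₀ : ℝ) {a b : EuclideanSpace ℝ (Fin 3)}
    (hab : LinearIndependent ℝ ![a, b]) {Φ : EuclideanSpace ℂ (Fin 2 × Fin 2)} (hΦ : ‖Φ‖ = 1) :
    (stateMeasure traceSnd Φ).map
        (fun ρ => (mean (observable a₀ a) ρ, mean (observable b₀ b) ρ)) =
      (volume : Measure (ℝ × ℝ)).withDensity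
        (fun p => ENNReal.ofReal (meanDensity a₀ b₀ a b p.1 p.2)) := by
  have hm : Measurable fun ρ => (mean (observable a₀ a) ρ, mean (observable b₀ b) ρ) :=
    ((continuous_mean _).prodMk (continuous_mean _)).measurable
  have hd := (measurable_meanDensity a₀ b₀ a b).ennreal_ofReal
  set μ := (stateMeasure traceSnd Φ).map
    (fun ρ => (mean (observable a₀ a) ρ, mean (observable b₀ b) ρ)) with hμ
  set ν := (volume : Measure (ℝ × ℝ)).withDensity
    (fun p => ENNReal.ofReal (meanDensity a₀ b₀ a b p.1 p.2)) with hν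
  have key : ∀ (α β : ℝ) (h : ℝ → ℝ≥0∞), Measurable h → ¬(α = 0 ∧ β = 0) →
      ∫⁻ p, h (α * p.1 + β * p.2) ∂μ = ∫⁻ p, h (α * p.1 + β * p.2) ∂ν := by
    intro α β h hh hαβ
    rw [hμ, lintegral_map (by fun_prop) hm, hν,
      lintegral_withDensity_eq_lintegral_mul _ hd (by fun_prop)]
    refine Eq.trans ?_ (lintegral_meanDensity_linear hab a₀ b₀ hh hαβ).symm
    rw [← lintegral_mean_observable hh hΦ]
    refine lintegral_congr fun ρ => ?_
    congr 1
    have e : ∑ i, (((α • a + β • b) i : ℝ) : ℂ) • pauli i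
        = (α : ℂ) • ∑ i, (a i : ℂ) • pauli i + (β : ℂ) • ∑ i, (b i : ℂ) • pauli i := by
      rw [Finset.smul_sum, Finset.smul_sum, ← Finset.sum_add_distrib]
      refine Finset.sum_congr rfl fun i _ => ?_
      simp only [PiLp.add_apply, PiLp.smul_apply, smul_eq_mul, Complex.ofReal_add,
        Complex.ofReal_mul, add_smul, smul_smul]
    rw [mean_observable, mean_observable, mean_observable, e, Matrix.add_mul, Matrix.trace_add,
      smul_mul_assoc, smul_mul_assoc, Matrix.trace_smul, Matrix.trace_smul, smul_eq_mul,
      smul_eq_mul, Complex.add_re, Complex.re_ofReal_mul, Complex.re_ofReal_mul]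
    ring
  have hμp : IsProbabilityMeasure μ := Measure.isProbabilityMeasure_map hm.aemeasurable
  -- The normalization of the density comes for free from the equality of one marginal, tested on a
  -- constant.
  have hνp : IsProbabilityMeasure ν := ⟨by
    have := key 1 0 (fun _ => 1) measurable_const (by simp)
    simpa using this.symm⟩
  refine Measure.ext_of_charFunDual (funext fun L => ?_)
  rw [charFunDual_eq_charFun_map_one, charFunDual_eq_charFun_map_one]
  congr 1
  have hLm : Measurable L := L.continuous.measurable
  have hL : ∀ p : ℝ × ℝ, L p = L (1, 0) * p.1 + L (0, 1) * p.2 := by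
    intro p
    have : p = p.1 • ((1, 0) : ℝ × ℝ) + p.2 • ((0, 1) : ℝ × ℝ) := by ext <;> simp
    conv_lhs => rw [this]
    rw [map_add, map_smul, map_smul, smul_eq_mul, smul_eq_mul, mul_comm, mul_comm p.2]
  refine Measure.ext_of_lintegral _ fun h hh => ?_
  rw [lintegral_map hh hLm, lintegral_map hh hLm]
  have hL' : (fun p => h (L p)) = fun p => h (L (1, 0) * p.1 + L (0, 1) * p.2) :=
    funext fun p => congrArg h (hL p)
  rw [hL']
  -- For the zero functional only the equality of total masses is needed.
  by_cases h0 : L (1, 0) = 0 ∧ L (0, 1) = 0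
  · simp [h0.1, h0.2]
  · exact key _ _ h hh h0

end QubitUncertainty

theorem proposition8
    (a₀ b₀ : ℝ) (a b : EuclideanSpace ℝ (Fin 3)) (hab : LinearIndependent ℝ ![a, b])
    (Φ : EuclideanSpace ℂ (Fin 2 × Fin 2)) (hΦ : ‖Φ‖ = 1)
    (tr : QubitUncertainty.PairOp → QubitUncertainty.QubitOp)
    (htr : tr = QubitUncertainty.traceFst ∨ tr = QubitUncertainty.traceSnd) :
    (QubitUncertainty.stateMeasure tr Φ).map
        (fun ρ => (QubitUncertainty.mean (QubitUncertainty.observable a₀ a) ρ,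
          QubitUncertainty.mean (QubitUncertainty.observable b₀ b) ρ)) =
      (volume : Measure (ℝ × ℝ)).withDensity
        (fun p => ENNReal.ofReal (QubitUncertainty.meanDensity a₀ b₀ a b p.1 p.2)) ∧
    (QubitUncertainty.stateMeasure tr Φ).map
        (fun ρ => (QubitUncertainty.uncertainty (QubitUncertainty.observable a₀ a) ρ,
          QubitUncertainty.uncertainty (QubitUncertainty.observable b₀ b) ρ)) =
      (volume : Measure (ℝ × ℝ)).withDensity
        (fun p => ENNReal.ofReal (QubitUncertainty.uncertaintyDensity a₀ b₀ a b p.1 p.2)) := by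
  rw [QubitUncertainty.stateMeasure_eq_traceSnd htr]
  have hmean := QubitUncertainty.map_mean_eq a₀ b₀ hab hΦ
  refine ⟨hmean, Measure.ext_of_lintegral _ fun h hh => ?_⟩
  have hm : Measurable fun ρ => (QubitUncertainty.mean (QubitUncertainty.observable a₀ a) ρ,
      QubitUncertainty.mean (QubitUncertainty.observable b₀ b) ρ) :=
    ((QubitUncertainty.continuous_mean _).prodMk (QubitUncertainty.continuous_mean _)).measurable
  have hm' : Measurable fun ρ => (QubitUncertainty.uncertainty (QubitUncertainty.observable a₀ a) ρ,
      QubitUncertainty.uncertainty (QubitUncertainty.observable b₀ b) ρ) :=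
    ((QubitUncertainty.continuous_uncertainty _).prodMk
      (QubitUncertainty.continuous_uncertainty _)).measurable
  have hg : Measurable fun p : ℝ × ℝ =>
      h (√(‖a‖ ^ 2 - (p.1 - a₀) ^ 2), √(‖b‖ ^ 2 - (p.2 - b₀) ^ 2)) := hh.comp (by fun_prop)
  rw [lintegral_map hh hm', lintegral_withDensity_eq_lintegral_mul _
    (QubitUncertainty.measurable_uncertaintyDensity a₀ b₀ a b).ennreal_ofReal hh]
  -- Both sides are expressed through the law of the means: almost every state has trace one, where
  -- each uncertainty is a function of the corresponding mean.
  refine Eq.trans ?_ (QubitUncertainty.lintegral_uncertaintyDensity hab a₀ b₀ hh)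
  refine Eq.trans ?_ (lintegral_withDensity_eq_lintegral_mul _
    (QubitUncertainty.measurable_meanDensity a₀ b₀ a b).ennreal_ofReal hg)
  rw [← hmean, lintegral_map hg hm]
  refine lintegral_congr_ae ?_
  filter_upwards [QubitUncertainty.ae_trace_eq_one hΦ] with ρ hρ
  rw [QubitUncertainty.uncertainty_observable a₀ a hρ,
    QubitUncertainty.uncertainty_observable b₀ b hρ]
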